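/- **Setting.** Let $d\ge 2$ be an integer and $w_j(\mu)=(1-\mu^2)^{(d-3)/2+j}$ for $\mu\in(-1,1)$, $j\in\mathbb N_0$. Let $C_\ell^{\lambda}$ denote the Gegenbauer polynomials and put $Q_\ell(\mu)=C_\ell^{(d-2)/2}(\mu)/C_\ell^{(d-2)/2}(1)$, which for $d=2$ is understood as the limit, i.e. the Chebyshev polynomial $T_\ell(\mu)$. Let $h(0,d)=1$, $h(\ell,d)=(2\ell+d-2)\frac{(\ell+d-3)!}{(d-2)!\,\ell!}$ for $\ell\ge1$, and $\omega_d=2\pi^{d/2}/\Gamma(d/2)$. Real functions on $(-1,1)$ are identified if they agree almost everywhere, derivatives are weak derivatives on $(-1,1)$, and $\ell^0=1$ also for $\ell=0$. For $n\in\mathbb N_0$ put $$\|u\|_{V^n}^2=\sum_{j=0}^n\int_{-1}^1|u^{(j)}(\mu)|^2\,w_j(\mu)\,d\mu ,$$ and let $V^n(-1,1)$ be the space of functions of finite $V^n$-norm that lie in the closure, with respect to this norm, of the standard Sobolev space $H^n(-1,1)$. For $n<\eta<n+1$ with $n \in \mathbb N_0$ let $V^\eta(-1,1)=(V^n(-1,1),V^{n+1}(-1,1))_{\eta-n,2}$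 be the real interpolation space with norm $$\|u\|_{V^\eta}^2=\int_0^\infty t^{-2(\eta-n)}K(t,u)^2\,\frac{dt}{t},\qquad K(t,u)=\inf_{u=v+w}\bigl(\|v\|_{V^n}+t\|w\|_{V^{n+1}}\bigr),$$ where the infimum is over $v\in V^n(-1,1)$, $w\in V^{n+1}(-1,1)$. For measurable $u$ with $\int_{-1}^1|u|\,w_0\,d\mu<\infty$ set $u_\ell=\int_{-1}^1u(\mu)\,Q_\ell(\mu)\,w_0(\mu)\,d\mu$, $\ell\in\mathbb N_0$. **Theorem.** Let $d\ge2$. 1. Let $\eta\ge0$. For every measurable $u$ on $(-1,1)$ with $\int_{-1}^1|u|\,w_0\,d\mu<\infty$ (this holds for every $u\in L^2(-1,1)$ if $d\ge3$), $$u\in V^\eta(-1,1)\iff\sum_{\ell=0}^\infty u_\ell^2\,\ell^{\,d-2+2\eta}<\infty .$$ Moreover, there are constants $0<c\le C<\infty$, depending only on $d$ and $\eta$, such that for all $u\in V^\eta(-1,1)$ $$c\Bigl(u_0^2+\sum_{\ell=0}^\infty u_\ell^2\,\ell^{\,d-2+2\eta}\Bigr)\le\|u\|_{V^\eta}^2\le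 C\Bigl(u_0^2+\sum_{\ell=0}^\infty u_\ell^2\,\ell^{\,d-2+2\eta}\Bigr).$$ 2. Let $(A_\ell)_{\ell\in\mathbb N_0}$ be an angular power spectrum on $\mathbb S^{d-1}$, i.e. $A_\ell\ge0$ and $\sum_\ell A_\ell\,h(\ell,d)<\infty$, and let $$k_I(\mu)=\frac1{\omega_d}\sum_{\ell=0}^\infty A_\ell\,Q_\ell(\mu)\,h(\ell,d),\qquad\mu\in[-1,1],$$ be the corresponding covariance kernel as a function of the inner product. Then, for every $n\in\mathbb N_0$, the sequence $(\ell^{\,d/2-1+n}A_\ell)_{\ell\ge n}$ is square summable if and only if $k_I$ has an $n$-th weak derivative on $(-1,1)$ for which $(1-\mu^2)^{(d-3)/4+n/2}\,\frac{\partial^n}{\partial\mu^n}k_I(\mu)$ is in $L^2(-1,1)$. -/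

import Mathlib

open MeasureTheory Set
open scoped ENNReal

noncomputable section

/-! ## Gegenbauer polynomials and covariance kernels on the sphere -/

namespace IsoGRF

/-- The Jacobi polynomial `P_ℓ^{(α,β)}`,
`∑_ν (ℓ+α+β+1)_ν (α+ν+1)_{ℓ-ν} / (ν! (ℓ-ν)!) ((X-1)/2)^ν`, where `(a)_ν = a(a+1)⋯(a+ν-1)`. -/
def jacobi (α β : ℝ) (l : ℕ) : Polynomial ℝ :=
  ∑ ν ∈ Finset.range (l + 1),
    Polynomial.C ((ascPochhammer ℝ ν).eval ((l : ℝ) + α + β + 1)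
        * (ascPochhammer ℝ (l - ν)).eval (α + ν + 1)
        / ((ν.factorial : ℝ) * ((l - ν).factorial : ℝ)))
      * (Polynomial.C (1 / 2 : ℝ) * (Polynomial.X - 1)) ^ ν

/-- The Gegenbauer polynomial `C_ℓ^lam` (for `lam > 0`). -/
def gegenbauer (lam : ℝ) (l : ℕ) : Polynomial ℝ :=
  Polynomial.C (Real.Gamma (lam + 1 / 2) * Real.Gamma (l + 2 * lam)
      / (Real.Gamma (2 * lam) * Real.Gamma (l + lam + 1 / 2)))
    * jacobi (lam - 1 / 2) (lam - 1 / 2) l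

/-- The normalized Gegenbauer polynomial `C_ℓ^{(d-2)/2}(x) / C_ℓ^{(d-2)/2}(1)`. For `d = 2` this
quotient is understood, as usual, as its limit, the Chebyshev polynomial `T_ℓ(x)`. -/
def zonal (d l : ℕ) (x : ℝ) : ℝ :=
  if d = 2 then (Polynomial.Chebyshev.T ℝ (l : ℤ)).eval x
  else (gegenbauer (((d : ℝ) - 2) / 2) l).eval x / (gegenbauer (((d : ℝ) - 2) / 2) l).eval 1

/-- `h(ℓ,d)`, the number of linearly independent spherical harmonics of degree `ℓ` on the unit
sphere of `ℝ^d`; the case `ℓ = 0` is separate since `(ℓ+d-3)!` makes no sense for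
`ℓ = 0`, `d = 2`. -/
def harmDim (l d : ℕ) : ℝ :=
  if l = 0 then 1
  else (2 * (l : ℝ) + d - 2) * ((l + d - 3).factorial : ℝ)
    / (((d - 2).factorial : ℝ) * (l.factorial : ℝ))

/-- The total area of the unit sphere of `ℝ^d`. -/
def sphereArea (d : ℕ) : ℝ :=
  2 * Real.pi ^ (1 + ((d : ℝ) - 2) / 2) / Real.Gamma (1 + ((d : ℝ) - 2) / 2)

/-- The covariance kernel with angular power spectrum `A` as a function of the angular distance. -/
def kernelDist (d : ℕ) (A : ℕ → ℝ) (r : ℝ) : ℝ :=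
  1 / sphereArea d * ∑' l : ℕ, A l * zonal d l (Real.cos r) * harmDim l d

/-- The covariance kernel `k_I` as a function of the inner product. -/
def kernelInner (d : ℕ) (A : ℕ → ℝ) (μ : ℝ) : ℝ :=
  kernelDist d A (Real.arccos μ)

/-! ## Weighted Sobolev spaces on `(-1,1)` -/

/-- The weight `(1-μ^2)^{(d-3)/2+j}`. -/
def weight (d j : ℕ) (μ : ℝ) : ℝ := (1 - μ ^ 2) ^ (((d : ℝ) - 3) / 2 + j)

/-- The Gegenbauer coefficient `u_ℓ` of `u`. -/
def coeff (d l : ℕ) (u : ℝ → ℝ) : ℝ :=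
  ∫ x in Ioo (-1 : ℝ) 1, u x * zonal d l x * weight d 0 x

/-- `v` is the `j`-th weak derivative of `u` on `(-1,1)`. -/
def HasWeakDeriv (j : ℕ) (u v : ℝ → ℝ) : Prop :=
  LocallyIntegrableOn u (Ioo (-1 : ℝ) 1) ∧ LocallyIntegrableOn v (Ioo (-1 : ℝ) 1) ∧
    ∀ φ : ℝ → ℝ, ContDiff ℝ (⊤ : ℕ∞) φ → HasCompactSupport φ → tsupport φ ⊆ Ioo (-1 : ℝ) 1 →
      ∫ x in Ioo (-1 : ℝ) 1, u x * iteratedDeriv j φ x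
        = (-1) ^ j * ∫ x in Ioo (-1 : ℝ) 1, v x * φ x

/-- The standard Sobolev space `H^n(-1,1)`. -/
def HSpace (n : ℕ) : Set (ℝ → ℝ) :=
  {u | ∀ j ≤ n, ∃ v : ℝ → ℝ, HasWeakDeriv j u v ∧
    MemLp v 2 (volume.restrict (Ioo (-1 : ℝ) 1))}

/-- The squared seminorm `∫ |u^{(j)}|^2 (1-μ^2)^{(d-3)/2+j}`, with the weak derivative `u^{(j)}`
(unique up to null sets); it is `∞` if there is no such weak derivative. -/
def seminormSq (d j : ℕ) (u : ℝ → ℝ) : ℝ≥0∞ :=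
  ⨅ (v : ℝ → ℝ) (_ : HasWeakDeriv j u v),
    ∫⁻ x in Ioo (-1 : ℝ) 1, ENNReal.ofReal (v x ^ 2 * weight d j x)

/-- The squared weighted Sobolev norm of integer order `n`. -/
def intNormSq (d n : ℕ) (u : ℝ → ℝ) : ℝ≥0∞ :=
  ∑ j ∈ Finset.range (n + 1), seminormSq d j u

/-- The weighted Sobolev norm of integer order `n`. -/
def intNorm (d n : ℕ) (u : ℝ → ℝ) : ℝ≥0∞ := intNormSq d n u ^ (1 / 2 : ℝ)

/-- `V^n(-1,1)` for an integer `n`: the functions of finite weighted norm in the closure of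
`H^n(-1,1)` with respect to this norm. -/
def IntV (d n : ℕ) : Set (ℝ → ℝ) :=
  {u | intNorm d n u < ⊤ ∧ ∀ ε : ℝ≥0∞, 0 < ε → ∃ φ ∈ HSpace n, intNorm d n (u - φ) < ε}

/-- The `K`-functional of the couple `(V^n(-1,1), V^{n+1}(-1,1))`. -/
def kFunctional (d n : ℕ) (t : ℝ) (u : ℝ → ℝ) : ℝ≥0∞ :=
  ⨅ (v : ℝ → ℝ) (w : ℝ → ℝ) (_ : v ∈ IntV d n) (_ : w ∈ IntV d (n + 1))
    (_ : u =ᵐ[volume.restrict (Ioo (-1 : ℝ) 1)] v + w),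
    intNorm d n v + ENNReal.ofReal t * intNorm d (n + 1) w

/-- The squared norm `∫_0^∞ t^{-2θ} K(t,u)^2 dt/t` of the real interpolation space
`(V^n(-1,1), V^{n+1}(-1,1))_{θ,2}`. -/
def interpNormSq (d n : ℕ) (θ : ℝ) (u : ℝ → ℝ) : ℝ≥0∞ :=
  ∫⁻ t in Ioi (0 : ℝ), ENNReal.ofReal (t ^ (-2 * θ) / t) * kFunctional d n t u ^ 2

/-- `V^η(-1,1)` for real `η ≥ 0`: the space above if `η` is an integer, and otherwise the
interpolation space with `n = ⌊η⌋` and `θ = η - n`. -/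
def VSpace (d : ℕ) (η : ℝ) : Set (ℝ → ℝ) :=
  if η = ⌊η⌋₊ then IntV d ⌊η⌋₊ else {u | interpNormSq d ⌊η⌋₊ (η - ⌊η⌋₊) u < ⊤}

/-- The squared norm of `V^η(-1,1)`. -/
def VNormSq (d : ℕ) (η : ℝ) (u : ℝ → ℝ) : ℝ≥0∞ :=
  if η = ⌊η⌋₊ then intNormSq d ⌊η⌋₊ u else interpNormSq d ⌊η⌋₊ (η - ⌊η⌋₊) u

end IsoGRF

end

noncomputable section

namespace IsoGRF

open Polynomial Filter Topology

/-! ### The Gegenbauer differential equation -/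

/-! The zonal polynomials `Q_l` are the polynomial eigenfunctions of a singular Sturm–Liouville
operator on `(-1,1)`, and differentiation maps this family of equations to itself. Iterating the
divergence form of the equation gives `(w_n Q_l^{(n)})^{(n)} = (-1)^n E w_0 Q_l` with `E = ∏_{i<n}
(l-i)(l+d-2+i)`, which grows like `l^{2n}`. Cutoffs near `±1` justify testing a weak derivative
against `w_n Q_l^{(n)}` without boundary terms, so the coefficient of `u^{(n)}` against `Q_l^{(n)}`
is `E u_l` (`HasWeakDeriv.integral_zder`).

For fixed `n` the nonzero `Q_l^{(n)}` form a complete orthogonal system in `L^2(w_n)`: completeness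
is Weierstrass approximation, and the squared norms are `E ‖Q_l‖²`. Parseval then gives `∫
|u^{(n)}|² w_n = ∑ E u_l² / ‖Q_l‖²`. Conversely, Riesz–Fischer produces a function with coefficients
`E u_l`, and comparing two Parseval series shows that it is the weak derivative
(`exists_hasWeakDeriv_of_summable`). The product `‖Q_l‖² h(l,d)` does not depend on `l` and `h(l,d)`
grows like `l^{d-2}`, so `V^n` is a weighted sequence space. The closure condition in its definition
is automatic, because partial sums are polynomials.

For fractional order, cutting the expansion at `1+l ≤ 1/t` is an optimal splitting up to constants.
The squared `K`-functional is therefore comparable to `∑ u_l² (1+l)^{d-2+2n} min(1, t²(1+l)²)`, and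
integrating in `t`, with a scaling in each degree, yields the weight of order `η`.

For the second part, `|Q_l| ≤ 1` makes the kernel series uniformly convergent. The coefficients of
the kernel are a constant multiple of `A_l`, and the same Parseval criterion applies. -/

/-- The differential equation `(1-x^2) P'' - b x P' + lam P = 0`. -/
def IsGeg (b lam : ℝ) (P : ℝ[X]) : Prop :=
  (1 - X ^ 2) * derivative (derivative P) - C b * (X * derivative P) + C lam * P = 0

/-- Differentiating the equation once keeps its shape and only shifts the parameters. With `b = d -
1` the shift amounts to replacing `d` by `d + 2`. -/
theorem IsGeg.derivative {b lam : ℝ} {P : ℝ[X]} (h : IsGeg b lam P) :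
    IsGeg (b + 2) (lam - b) (derivative P) := by
  have h2 := congrArg Polynomial.derivative h
  simp only [derivative_add, derivative_sub, derivative_mul, derivative_one, derivative_X_pow,
    derivative_C, derivative_X, derivative_zero] at h2
  unfold IsGeg
  rw [← h2]
  simp only [map_add, map_sub, C_ofNat]
  push_cast
  simp only [map_ofNat]
  ring

theorem IsGeg.smul {b lam : ℝ} {P : ℝ[X]} (h : IsGeg b lam P) (c : ℝ) :
    IsGeg b lam (C c * P) := by
  unfold IsGeg at *
  simp only [derivative_C_mul]
  linear_combination C c * h

theorem IsGeg.sub {b lam : ℝ} {P R : ℝ[X]} (h : IsGeg b lam P) (h' : IsGeg b lam R) :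
    IsGeg b lam (P - R) := by
  unfold IsGeg at *
  simp only [derivative_sub]
  linear_combination h - h'

theorem coeff_X_mul_derivative (p : ℝ[X]) (n : ℕ) :
    (X * derivative p).coeff n = n * p.coeff n := by
  cases n with
  | zero => simp
  | succ n => rw [coeff_X_mul, coeff_derivative]; push_cast; ring

/-- Since `X² D² = (XD)² - XD`, every term except `P''` acts diagonally on monomials, which leaves a
two-step recurrence. -/
theorem IsGeg.coeff {b lam : ℝ} {P : ℝ[X]} (h : IsGeg b lam P) (n : ℕ) :
    ((n : ℝ) + 2) * (n + 1) * P.coeff (n + 2) = (n * (n - 1 + b) - lam) * P.coeff n := by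
  have h2 : Polynomial.derivative (Polynomial.derivative P)
      - (X * Polynomial.derivative (X * Polynomial.derivative P) - X * Polynomial.derivative P)
      - C b * (X * Polynomial.derivative P) + C lam * P = 0 := by
    rw [← h]; simp only [derivative_mul, derivative_X]; ring
  have h3 := congrArg (fun q => q.coeff n) h2
  simp only [coeff_add, coeff_sub, coeff_X_mul_derivative, coeff_C_mul, coeff_derivative,
    coeff_zero] at h3
  push_cast at h3
  have e : n + 1 + 1 = n + 2 := rfl
  rw [e] at h3
  linear_combination h3

/-- At the leading coefficient the recurrence forces `m(m+d-2) = l(l+d-2)`, whose only root among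
the natural numbers is `m = l`. -/
theorem IsGeg.natDegree {d l : ℕ} (hd : 2 ≤ d) {P : ℝ[X]}
    (h : IsGeg (d - 1) (l * (l + d - 2)) P) (h0 : P ≠ 0) : P.natDegree = l := by
  have h1 := h.coeff P.natDegree
  rw [coeff_eq_zero_of_natDegree_lt (show P.natDegree < P.natDegree + 2 by omega), mul_zero] at h1
  have h2 : P.coeff P.natDegree ≠ 0 := leadingCoeff_ne_zero.mpr h0
  have h3 := (mul_eq_zero.mp h1.symm).resolve_right h2
  set m := P.natDegree
  have hd' : (2 : ℝ) ≤ d := by exact_mod_cast hd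
  have h4 : ((m : ℝ) - l) * (m + l + d - 2) = 0 := by linear_combination h3
  rcases mul_eq_zero.mp h4 with h5 | h5
  · exact_mod_cast sub_eq_zero.mp h5
  · have hm : (0 : ℝ) ≤ m := by positivity
    have hl : (0 : ℝ) ≤ l := by positivity
    have : (m : ℝ) = l := by linarith
    exact_mod_cast this

/-- The combination of two solutions that cancels the coefficient of degree `l` is a solution
without admissible degree, hence zero. The polynomial solutions therefore form a line, and the value
at `1` fixes the scalar. -/
theorem IsGeg.eq_of_eval_one {d l : ℕ} (hd : 2 ≤ d) {P R : ℝ[X]}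
    (hP : IsGeg (d - 1) (l * (l + d - 2)) P) (hR : IsGeg (d - 1) (l * (l + d - 2)) R)
    (hR1 : R.eval 1 ≠ 0) (h1 : P.eval 1 = R.eval 1) : P = R := by
  have hR0 : R ≠ 0 := by rintro rfl; simp at hR1
  have hdR := hR.natDegree hd hR0
  set S := C (R.coeff l) * P - C (P.coeff l) * R with hS
  have hSg : IsGeg (d - 1) (l * (l + d - 2)) S := (hP.smul _).sub (hR.smul _)
  have hS0 : S = 0 := by
    by_contra hne
    have hl := hSg.natDegree hd hne
    have : S.coeff S.natDegree ≠ 0 := leadingCoeff_ne_zero.mpr hne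
    rw [hl] at this
    apply this
    simp [hS, mul_comm]
  have hc : R.coeff l ≠ 0 := by
    have : R.coeff R.natDegree ≠ 0 := leadingCoeff_ne_zero.mpr hR0
    rwa [hdR] at this
  have he : R.coeff l = P.coeff l := by
    have := congrArg (Polynomial.eval 1) hS0
    simp only [hS, eval_sub, eval_mul, eval_C, eval_zero, h1] at this
    have h2 : (R.coeff l - P.coeff l) * R.eval 1 = 0 := by linear_combination this
    exact sub_eq_zero.mp ((mul_eq_zero.mp h2).resolve_right hR1)
  have h3 : C (R.coeff l) * (P - R) = 0 := by
    rw [← hS0, hS, ← he]; ring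
  rcases mul_eq_zero.mp h3 with h4 | h4
  · exact absurd (C_eq_zero.mp h4) hc
  · exact sub_eq_zero.mp h4

/-! ### Jacobi polynomials as solutions of the Gegenbauer equation -/

/-- The coefficients of the Jacobi polynomial in powers of `(X-1)/2`. -/
def jacobiCoeff (α β : ℝ) (l ν : ℕ) : ℝ :=
  (ascPochhammer ℝ ν).eval ((l : ℝ) + α + β + 1)
        * (ascPochhammer ℝ (l - ν)).eval (α + ν + 1)
        / ((ν.factorial : ℝ) * ((l - ν).factorial : ℝ))

/-- The Jacobi polynomial in the variable `(X-1)/2`. -/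
def jacobiShift (α β : ℝ) (l : ℕ) : ℝ[X] :=
  ∑ ν ∈ Finset.range (l + 1), C (jacobiCoeff α β l ν) * X ^ ν

theorem jacobi_eq_comp (α β : ℝ) (l : ℕ) :
    jacobi α β l = (jacobiShift α β l).comp (C (1 / 2 : ℝ) * (X - 1)) := by
  rw [jacobiShift, ← coe_compRingHom_apply, map_sum]
  simp [jacobi, jacobiCoeff]

theorem jacobiShift_coeff (α β : ℝ) (l n : ℕ) :
    (jacobiShift α β l).coeff n = if n ≤ l then jacobiCoeff α β l n else 0 := by
  simp [jacobiShift, coeff_C_mul, coeff_X_pow]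

theorem jacobiCoeff_succ (α : ℝ) {l n : ℕ} (h : n < l) :
    ((n : ℝ) + 1) * (n + α + 1) * jacobiCoeff α α l (n + 1)
      = (l - n) * (l + n + 2 * α + 1) * jacobiCoeff α α l n := by
  obtain ⟨k, rfl⟩ := Nat.exists_eq_add_of_lt h
  have e1 : n + k + 1 - (n + 1) = k := by omega
  have e2 : n + k + 1 - n = k + 1 := by omega
  unfold jacobiCoeff
  rw [e1, e2]
  have h1 : (ascPochhammer ℝ (k + 1)).eval (α + n + 1)
      = (α + n + 1) * (ascPochhammer ℝ k).eval (α + n + 1 + 1) := by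
    rw [ascPochhammer_succ_left]; simp [eval_comp]
  rw [h1, ascPochhammer_succ_right, Nat.factorial_succ, Nat.factorial_succ]
  simp only [eval_mul, eval_add, eval_X, eval_natCast]
  have h2 : ((n.factorial : ℕ) : ℝ) ≠ 0 := by positivity
  have h3 : ((k.factorial : ℕ) : ℝ) ≠ 0 := by positivity
  have h4 : (n : ℝ) + 1 ≠ 0 := by positivity
  have h5 : (k : ℝ) + 1 ≠ 0 := by positivity
  have e3 : α + ((n + 1 : ℕ) : ℝ) + 1 = α + n + 1 + 1 := by push_cast; ring
  rw [e3]
  push_cast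
  field_simp
  ring

theorem jacobiShift_ode (α : ℝ) (l : ℕ) :
    X * (1 + X) * derivative (derivative (jacobiShift α α l))
      + C (α + 1) * (1 + 2 * X) * derivative (jacobiShift α α l)
      = C (l * (l + 2 * α + 1)) * jacobiShift α α l := by
  set p := jacobiShift α α l with hp
  have e : X * (1 + X) * derivative (derivative p) + C (α + 1) * (1 + 2 * X) * derivative p
      = X * derivative (derivative p) + (X * derivative (X * derivative p) - X * derivative p)
        + C (α + 1) * derivative p + C (2 * (α + 1)) * (X * derivative p) := by
    simp only [derivative_mul, derivative_X, C_mul, map_ofNat]; ring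
  rw [e]
  ext n
  simp only [coeff_add, coeff_sub, coeff_X_mul_derivative, coeff_C_mul, coeff_derivative]
  rw [hp, jacobiShift_coeff, jacobiShift_coeff]
  rcases lt_trichotomy n l with h | h | h
  · rw [if_pos (by omega), if_pos (by omega)]
    linear_combination jacobiCoeff_succ α h
  · subst h
    rw [if_neg (by omega), if_pos le_rfl]; ring
  · rw [if_neg (by omega), if_neg (by omega)]; ring

theorem isGeg_jacobi (α : ℝ) (l : ℕ) :
    IsGeg (2 * α + 2) (l * (l + 2 * α + 1)) (jacobi α α l) := by
  rw [jacobi_eq_comp]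
  have h := congrArg (fun q => q.comp (C (1 / 2 : ℝ) * (X - 1))) (jacobiShift_ode α l)
  set p := jacobiShift α α l
  simp only [add_comp, mul_comp, X_comp, C_comp, one_comp, ofNat_comp] at h
  unfold IsGeg
  have e1 : derivative (C (1 / 2 : ℝ) * (X - 1)) = C (1 / 2 : ℝ) := by simp
  simp only [derivative_comp, e1, derivative_mul, derivative_C, zero_mul,
    zero_add]
  set a := p.comp (C (1 / 2 : ℝ) * (X - 1))
  set a1 := (derivative p).comp (C (1 / 2 : ℝ) * (X - 1))
  set a2 := (derivative (derivative p)).comp (C (1 / 2 : ℝ) * (X - 1))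
  have e2 : (C (1 / 2 : ℝ) : ℝ[X]) * 2 = 1 := by
    rw [← C_ofNat, ← C_mul]; norm_num
  have e3 : (C (2 * α + 2) : ℝ[X]) = 2 * C (α + 1) := by
    rw [← C_ofNat, ← C_mul]; congr 1; ring
  rw [e3]
  set c := (C (1 / 2 : ℝ) : ℝ[X])
  linear_combination -h + e2 * (-X * c * a2 + c * a2 - C (α + 1) * a1)

theorem jacobi_eval_one (α β : ℝ) (l : ℕ) :
    (jacobi α β l).eval 1 = (ascPochhammer ℝ l).eval (α + 1) / l.factorial := by
  rw [jacobi_eq_comp, eval_comp]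
  have : (C (1 / 2 : ℝ) * (X - 1) : ℝ[X]).eval 1 = 0 := by simp
  rw [this, ← coeff_zero_eq_eval_zero, jacobiShift_coeff, if_pos (Nat.zero_le _)]
  simp [jacobiCoeff]

/-! ### Normalized zonal polynomials -/

/-- The polynomial `Q_l` with `zonal d l x = Q_l(x)`. -/
def zpoly (d l : ℕ) : ℝ[X] :=
  if d = 2 then Polynomial.Chebyshev.T ℝ (l : ℤ)
  else C ((jacobi (((d : ℝ) - 3) / 2) (((d : ℝ) - 3) / 2) l).eval 1)⁻¹
    * jacobi (((d : ℝ) - 3) / 2) (((d : ℝ) - 3) / 2) l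

theorem jacobi_eval_one_pos {d : ℕ} (hd : 2 ≤ d) (l : ℕ) :
    0 < (jacobi (((d : ℝ) - 3) / 2) (((d : ℝ) - 3) / 2) l).eval 1 := by
  rw [jacobi_eval_one]
  have hd' : (2 : ℝ) ≤ d := by exact_mod_cast hd
  exact div_pos (ascPochhammer_pos _ _ (by linarith)) (by positivity)

/-- For `d ≥ 3` the Gamma factors are positive and cancel on dividing by the value at `1`. -/
theorem zonal_eq_eval {d : ℕ} (hd : 2 ≤ d) (l : ℕ) (x : ℝ) :
    zonal d l x = (zpoly d l).eval x := by
  unfold zonal zpoly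
  split_ifs with h
  · rfl
  · have hd' : (3 : ℝ) ≤ d := by exact_mod_cast (by omega : 3 ≤ d)
    have e : ((d : ℝ) - 2) / 2 - 1 / 2 = (d - 3) / 2 := by ring
    simp only [gegenbauer, eval_mul, eval_C, e]
    have hl : (0 : ℝ) ≤ l := by positivity
    have h1 := Real.Gamma_pos_of_pos (show 0 < ((d : ℝ) - 2) / 2 + 1 / 2 by linarith)
    have h2 := Real.Gamma_pos_of_pos (show 0 < (l : ℝ) + 2 * (((d : ℝ) - 2) / 2) by linarith)
    have h3 := Real.Gamma_pos_of_pos (show 0 < 2 * (((d : ℝ) - 2) / 2) by linarith)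
    have h4 := Real.Gamma_pos_of_pos (show 0 < (l : ℝ) + ((d : ℝ) - 2) / 2 + 1 / 2 by linarith)
    rw [mul_div_mul_left _ _ (by positivity)]
    rw [div_eq_mul_inv, mul_comm]

theorem zpoly_eval_one {d : ℕ} (hd : 2 ≤ d) (l : ℕ) : (zpoly d l).eval 1 = 1 := by
  unfold zpoly
  split_ifs with h
  · simp
  · rw [eval_mul, eval_C, inv_mul_cancel₀ (jacobi_eval_one_pos hd l).ne']

theorem zpoly_ne_zero {d : ℕ} (hd : 2 ≤ d) (l : ℕ) : zpoly d l ≠ 0 := by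
  intro h
  have := zpoly_eval_one hd l
  simp [h] at this

theorem isGeg_zpoly (d l : ℕ) :
    IsGeg (d - 1) (l * (l + d - 2)) (zpoly d l) := by
  unfold zpoly
  split_ifs with h
  · subst h
    have := Polynomial.Chebyshev.one_sub_X_sq_mul_derivative_derivative_T_eq_poly_in_T
      (R := ℝ) (l : ℤ)
    unfold IsGeg
    simp only [Function.iterate_succ, Function.iterate_zero, Function.comp, id] at this
    have e1 : ((2 : ℕ) : ℝ) - 1 = 1 := by norm_num
    have e2 : (l : ℝ) * (l + (2 : ℕ) - 2) = (l : ℝ) ^ 2 := by push_cast; ring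
    rw [e1, e2]
    simp only [C_1, C_pow, C_eq_natCast]
    push_cast at this
    linear_combination this
  · have := (isGeg_jacobi (((d : ℝ) - 3) / 2) l).smul
      ((jacobi (((d : ℝ) - 3) / 2) (((d : ℝ) - 3) / 2) l).eval 1)⁻¹
    convert this using 2 <;> ring

theorem zpoly_natDegree {d : ℕ} (hd : 2 ≤ d) (l : ℕ) : (zpoly d l).natDegree = l :=
  (isGeg_zpoly d l).natDegree hd (zpoly_ne_zero hd l)

theorem IsGeg.eq_C_mul_zpoly {d l : ℕ} (hd : 2 ≤ d) {P : ℝ[X]}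
    (hP : IsGeg (d - 1) (l * (l + d - 2)) P) : P = C (P.eval 1) * zpoly d l := by
  -- Subtracting `P(1) - 1` times `Q_l` makes the value at `1` equal to `1`, so the case `P(1) = 0`
  -- needs no separate treatment.
  have h := (hP.sub ((isGeg_zpoly d l).smul (P.eval 1 - 1))).eq_of_eval_one hd
    (isGeg_zpoly d l) (by rw [zpoly_eval_one hd]; exact one_ne_zero)
    (by simp [zpoly_eval_one hd])
  rw [C_sub, C_1] at h
  linear_combination h

/-- The equation is invariant under `x ↦ -x`, so the reflected polynomial lies on the same line of
solutions. -/
theorem zpoly_comp_neg_X {d : ℕ} (hd : 2 ≤ d) (l : ℕ) :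
    (zpoly d l).comp (-X) = C ((zpoly d l).eval (-1)) * zpoly d l := by
  have h : IsGeg (d - 1) (l * (l + d - 2)) ((zpoly d l).comp (-X)) := by
    have h1 := congrArg (fun q => q.comp (-X)) (isGeg_zpoly d l)
    unfold IsGeg
    simp only [add_comp, sub_comp, mul_comp, X_comp, C_comp, one_comp, pow_comp, zero_comp] at h1
    simp only [derivative_comp, derivative_mul, derivative_neg, derivative_X, derivative_one,
      neg_zero]
    linear_combination h1
  have h2 := h.eq_C_mul_zpoly hd
  rwa [eval_comp, eval_neg, eval_X] at h2

theorem zpoly_eval_neg_one_sq {d : ℕ} (hd : 2 ≤ d) (l : ℕ) :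
    (zpoly d l).eval (-1) ^ 2 = 1 := by
  have h := congrArg (Polynomial.eval (-1)) (zpoly_comp_neg_X hd l)
  simp only [eval_comp, eval_neg, eval_X, neg_neg, zpoly_eval_one hd, eval_mul, eval_C] at h
  rw [sq, ← h]

theorem zpoly_zero {d : ℕ} (hd : 2 ≤ d) : zpoly d 0 = 1 := by
  have h1 := eq_C_of_natDegree_eq_zero (zpoly_natDegree hd 0)
  have h2 := zpoly_eval_one hd 0
  rw [h1, eval_C] at h2
  rw [h1, h2, C_1]

/-- The derivative solves the equation of dimension `d + 2` and degree `l`. At `x = 1` the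
second-order term vanishes, so the equation there gives the value of the derivative and hence the
constant. -/
theorem derivative_zpoly_succ {d : ℕ} (hd : 2 ≤ d) (l : ℕ) :
    derivative (zpoly d (l + 1))
      = C (((l : ℝ) + 1) * (l + d - 1) / (d - 1)) * zpoly (d + 2) l := by
  have hd' : (2 : ℝ) ≤ d := by exact_mod_cast hd
  have hg := isGeg_zpoly d (l + 1)
  have h : IsGeg ((d + 2 : ℕ) - 1) (l * (l + (d + 2 : ℕ) - 2)) (derivative (zpoly d (l + 1))) := by
    convert hg.derivative using 1 <;> push_cast <;> ring
  have h2 := h.eq_C_mul_zpoly (by omega)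
  have h3 := congrArg (Polynomial.eval 1) hg
  simp only [eval_add, eval_sub, eval_mul, eval_C, eval_one, eval_pow, eval_X, eval_zero,
    zpoly_eval_one hd] at h3
  rw [h2]
  congr 2
  have : (d : ℝ) - 1 ≠ 0 := by linarith
  field_simp
  push_cast at h3
  linear_combination -h3

theorem abs_zpoly_eval_le_one {d : ℕ} (hd : 2 ≤ d) (l : ℕ) {x : ℝ} (hx : x ∈ Icc (-1 : ℝ) 1) :
    |(zpoly d l).eval x| ≤ 1 := by
  rcases Nat.eq_zero_or_pos l with rfl | hl
  · simp [zpoly_zero hd]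
  have hd' : (2 : ℝ) ≤ d := by exact_mod_cast hd
  have hl' : (1 : ℝ) ≤ l := by exact_mod_cast hl
  set lam : ℝ := l * (l + d - 2)
  have hlam : 0 < lam := by
    apply mul_pos <;> linarith
  set Q := zpoly d l with hQ
  -- Sonin's function: it dominates `Q²`, equals `1` at `±1`, and by the differential equation its
  -- derivative is `2(d-2) x Q'² / lam`. It thus does not decrease away from `0`, and its endpoint
  -- values bound it.
  set f : ℝ[X] := Q ^ 2 + C lam⁻¹ * ((1 - X ^ 2) * derivative Q ^ 2) with hf
  have hder : derivative f = C (2 * (d - 2) * lam⁻¹) * (X * derivative Q ^ 2) := by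
    have hg : IsGeg (d - 1) lam Q := isGeg_zpoly d l
    unfold IsGeg at hg
    have e : (C lam⁻¹ : ℝ[X]) * C lam = 1 := by
      rw [← C_mul, inv_mul_cancel₀ hlam.ne', C_1]
    have e2 : (C (2 * (d - 2) * lam⁻¹) : ℝ[X]) = 2 * (C ((d : ℝ) - 1) - 1) * C lam⁻¹ := by
      rw [← C_1, ← C_sub, ← C_ofNat, ← C_mul, ← C_mul]; congr 1; ring
    rw [e2, hf]
    simp only [derivative_add, derivative_mul, derivative_pow, derivative_sub, derivative_one,
      derivative_C, derivative_X]
    norm_num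
    have e3 : (C ((d : ℝ) - 1) : ℝ[X]) = d - 1 := by simp
    have e4 : (C (2 : ℝ) : ℝ[X]) = 2 := map_ofNat C 2
    linear_combination (2 * C lam⁻¹ * derivative Q) * hg - 2 * derivative Q * Q * e
      + 2 * derivative Q ^ 2 * C lam⁻¹ * X * e3
      + (Q * derivative Q - derivative Q * C lam⁻¹ * X ^ 2 * derivative (derivative Q)
        + derivative Q * C lam⁻¹ * derivative (derivative Q) - derivative Q ^ 2 * C lam⁻¹ * X) * e4
  have hderiv : ∀ y, deriv (fun y => f.eval y) y
      = 2 * (d - 2) * lam⁻¹ * (y * (derivative Q).eval y ^ 2) := by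
    intro y
    rw [Polynomial.deriv, hder]; simp
  have hc : 0 ≤ 2 * ((d : ℝ) - 2) * lam⁻¹ := by
    have : 0 ≤ (d : ℝ) - 2 := by linarith
    positivity
  have hend : ∀ y : ℝ, y ^ 2 = 1 → Q.eval y ^ 2 = 1 → f.eval y = 1 := by
    intro y h1 h2
    simp [hf, h1, h2]
  have hfx : f.eval x ≤ 1 := by
    rcases le_total 0 x with h0 | h0
    · have hm : MonotoneOn (fun y => f.eval y) (Icc 0 1) := by
        apply monotoneOn_of_deriv_nonneg (convex_Icc 0 1) (by fun_prop) (by fun_prop)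
        intro y hy
        rw [interior_Icc] at hy
        rw [hderiv]
        have := hy.1.le
        positivity
      have := hm ⟨h0, hx.2⟩ ⟨zero_le_one, le_rfl⟩ hx.2
      simpa [hend 1 (by norm_num) (by rw [hQ, zpoly_eval_one hd]; norm_num)] using this
    · have hm : AntitoneOn (fun y => f.eval y) (Icc (-1) 0) := by
        apply antitoneOn_of_deriv_nonpos (convex_Icc _ _) (by fun_prop) (by fun_prop)
        intro y hy
        rw [interior_Icc] at hy
        rw [hderiv]
        apply mul_nonpos_of_nonneg_of_nonpos hc
        exact mul_nonpos_of_nonpos_of_nonneg hy.2.le (sq_nonneg _)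
      have := hm ⟨le_rfl, by norm_num⟩ ⟨hx.1, h0⟩ hx.1
      simpa [hend (-1) (by norm_num) (zpoly_eval_neg_one_sq hd l)] using this
  have h1 : Q.eval x ^ 2 ≤ f.eval x := by
    simp only [hf, eval_add, eval_mul, eval_pow, eval_sub, eval_one, eval_X, eval_C]
    have : 0 ≤ 1 - x ^ 2 := by nlinarith [hx.1, hx.2]
    have := mul_nonneg (inv_nonneg.mpr hlam.le)
      (mul_nonneg this (sq_nonneg ((derivative Q).eval x)))
    linarith
  exact abs_le_one_iff_mul_self_le_one.mpr (by nlinarith)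

theorem isGeg_iterate_zpoly (d l j : ℕ) :
    IsGeg (d - 1 + 2 * j) ((l - j) * (l + d - 2 + j)) (derivative^[j] (zpoly d l)) := by
  induction j with
  | zero => simpa using isGeg_zpoly d l
  | succ j ih =>
    rw [Function.iterate_succ_apply']
    convert ih.derivative using 1 <;> push_cast <;> ring

/-! ### Cutoff functions near the end points -/

theorem one_sub_sq_pos {x : ℝ} (hx : x ∈ Ioo (-1 : ℝ) 1) : 0 < 1 - x ^ 2 := by
  nlinarith [hx.1, hx.2]

theorem mem_Ioo_of_one_sub_sq_pos {x : ℝ} (hx : 0 < 1 - x ^ 2) : x ∈ Ioo (-1 : ℝ) 1 :=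
  ⟨by nlinarith, by nlinarith⟩

theorem hasDerivAt_one_sub_sq (x : ℝ) : HasDerivAt (fun x : ℝ => 1 - x ^ 2) (-2 * x) x := by
  simpa using (hasDerivAt_pow 2 x).const_sub 1

theorem contDiff_eval (q : ℝ[X]) {n : WithTop ℕ∞} : ContDiff ℝ n fun x => q.eval x := by
  simpa using q.contDiff_aeval (𝕜 := ℝ) n

/-- Smooth functions vanishing on `(-∞,1]` and equal to the constant `L` on `[2,∞)`. -/
structure IsCutoff (Ψ : ℝ → ℝ) (L : ℝ) : Prop where
  smooth : ContDiff ℝ (⊤ : ℕ∞) Ψ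
  zero : ∀ t ≤ 1, Ψ t = 0
  const : ∀ t, 2 ≤ t → Ψ t = L

theorem isCutoff_smoothTransition : IsCutoff (fun t => Real.smoothTransition (t - 1)) 1 where
  smooth := Real.smoothTransition.contDiff.comp (contDiff_id.sub contDiff_const)
  zero t ht := Real.smoothTransition.zero_of_nonpos (by linarith)
  const t ht := Real.smoothTransition.one_of_one_le (by linarith)

/-- With `s = (1-x²)/ε`, the derivative of `Ψ(s)` in `x` is `-2x (1-x²)⁻¹ · sΨ'(s)`. The factor
`1/ε` is absorbed because `sΨ'(s)` is again a cutoff, with limit `0`; this is why the limit `L` is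
kept general. -/
theorem IsCutoff.mul_deriv {Ψ : ℝ → ℝ} {L : ℝ} (h : IsCutoff Ψ L) :
    IsCutoff (fun t => t * deriv Ψ t) 0 where
  smooth := contDiff_id.mul ((contDiff_infty_iff_deriv.mp h.smooth).2)
  zero t ht := by
    have hz : ∀ t < 1, deriv Ψ t = 0 := fun t ht => by
      have : Ψ =ᶠ[𝓝 t] fun _ => 0 := by
        filter_upwards [Iio_mem_nhds ht] with y hy using h.zero y (le_of_lt hy)
      rw [this.deriv_eq]; simp
    have hc : Continuous (deriv Ψ) := (contDiff_infty_iff_deriv.mp h.smooth).2.continuous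
    have : t ∈ closure (Iio (1 : ℝ)) := by rw [closure_Iio]; exact ht
    have h0 : deriv Ψ t = 0 :=
      closure_minimal (s := Iio (1 : ℝ)) (t := {t | deriv Ψ t = 0}) hz
        (isClosed_eq hc continuous_const) this
    simp [h0]
  const t ht := by
    have hz : ∀ t > 2, deriv Ψ t = 0 := fun t ht => by
      have : Ψ =ᶠ[𝓝 t] fun _ => L := by
        filter_upwards [Ioi_mem_nhds ht] with y hy using h.const y (le_of_lt hy)
      rw [this.deriv_eq]; simp
    have hc : Continuous (deriv Ψ) := (contDiff_infty_iff_deriv.mp h.smooth).2.continuous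
    have : t ∈ closure (Ioi (2 : ℝ)) := by rw [closure_Ioi]; exact ht
    have h0 : deriv Ψ t = 0 :=
      closure_minimal (s := Ioi (2 : ℝ)) (t := {t | deriv Ψ t = 0}) hz
        (isClosed_eq hc continuous_const) this
    simp [h0]

theorem IsCutoff.bounded {Ψ : ℝ → ℝ} {L : ℝ} (h : IsCutoff Ψ L) : ∃ C, ∀ t, |Ψ t| ≤ C := by
  obtain ⟨C, hC⟩ := isCompact_Icc.exists_bound_of_continuousOn (s := Icc (1 : ℝ) 2)
    h.smooth.continuous.continuousOn
  refine ⟨max C |L|, fun t => ?_⟩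
  rcases le_total t 1 with h1 | h1
  · rw [h.zero t h1, abs_zero]; exact le_max_of_le_right (abs_nonneg _)
  rcases le_total t 2 with h2 | h2
  · exact le_max_of_le_left (hC t ⟨h1, h2⟩)
  · rw [h.const t h2]; exact le_max_right _ _

/-- A power of `1-x^2` times a polynomial, cut off near the end points. -/
def cutPow (b : ℝ) (q : ℝ[X]) (Ψ : ℝ → ℝ) (ε x : ℝ) : ℝ :=
  (1 - x ^ 2) ^ b * q.eval x * Ψ ((1 - x ^ 2) / ε)

theorem IsCutoff.cutPow_eventually_zero {Ψ : ℝ → ℝ} {L : ℝ} (h : IsCutoff Ψ L) (b : ℝ)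
    (q : ℝ[X]) {ε x : ℝ} (hε : 0 < ε) (hx : 1 - x ^ 2 ≤ 0) :
    cutPow b q Ψ ε =ᶠ[𝓝 x] fun _ => 0 := by
  have hc : Continuous fun x : ℝ => 1 - x ^ 2 := by fun_prop
  filter_upwards [hc.continuousAt.preimage_mem_nhds (Iio_mem_nhds (hx.trans_lt hε))] with y hy
  rw [cutPow, h.zero, mul_zero]
  rw [div_le_one hε]; exact le_of_lt hy

theorem IsCutoff.contDiff_cutPow {Ψ : ℝ → ℝ} {L : ℝ} (h : IsCutoff Ψ L) (b : ℝ) (q : ℝ[X])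
    {ε : ℝ} (hε : 0 < ε) : ContDiff ℝ (⊤ : ℕ∞) (cutPow b q Ψ ε) := by
  rw [contDiff_iff_contDiffAt]
  intro x
  rcases le_or_gt (1 - x ^ 2) 0 with hx | hx
  · exact contDiffAt_const.congr_of_eventuallyEq (h.cutPow_eventually_zero b q hε hx)
  · have hs : ContDiffAt ℝ (⊤ : ℕ∞) (fun x : ℝ => 1 - x ^ 2) x := by fun_prop
    unfold cutPow
    exact ((hs.rpow_const_of_ne hx.ne').mul (contDiff_eval q).contDiffAt).mul
      (h.smooth.contDiffAt.comp x (hs.div_const ε))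

theorem IsCutoff.tsupport_cutPow {Ψ : ℝ → ℝ} {L : ℝ} (h : IsCutoff Ψ L) (b : ℝ) (q : ℝ[X])
    {ε : ℝ} (hε : 0 < ε) : tsupport (cutPow b q Ψ ε) ⊆ Ioo (-1) 1 := by
  have hcl : IsClosed {x : ℝ | ε ≤ 1 - x ^ 2} := isClosed_le continuous_const (by fun_prop)
  have hsub : tsupport (cutPow b q Ψ ε) ⊆ {x : ℝ | ε ≤ 1 - x ^ 2} := by
    apply closure_minimal _ hcl
    intro x hx
    by_contra hlt
    apply hx
    rw [cutPow, h.zero, mul_zero]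
    rw [div_le_one hε]
    exact (not_le.mp hlt).le
  exact fun x hx => mem_Ioo_of_one_sub_sq_pos (hε.trans_le (hsub hx))

theorem hasCompactSupport_of_tsupport_subset_Ioo {φ : ℝ → ℝ} (h : tsupport φ ⊆ Ioo (-1) 1) :
    HasCompactSupport φ :=
  isCompact_Icc.of_isClosed_subset (isClosed_tsupport φ) (h.trans Ioo_subset_Icc_self)

theorem IsCutoff.deriv_cutPow {Ψ : ℝ → ℝ} {L : ℝ} (h : IsCutoff Ψ L) (b : ℝ) (q : ℝ[X])
    {ε : ℝ} (hε : 0 < ε) :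
    deriv (cutPow b q Ψ ε) =
      cutPow (b - 1) (C (-2 * b) * X * q + (1 - X ^ 2) * derivative q) Ψ ε
      + cutPow (b - 1) (C (-2) * X * q) (fun t => t * deriv Ψ t) ε := by
  funext x
  rw [Pi.add_apply]
  rcases le_or_gt (1 - x ^ 2) 0 with hx | hx
  · rw [(h.cutPow_eventually_zero b q hε hx).deriv_eq,
      (h.cutPow_eventually_zero _ _ hε hx).eq_of_nhds,
      (h.mul_deriv.cutPow_eventually_zero _ _ hε hx).eq_of_nhds]
    simp
  · have hs := hasDerivAt_one_sub_sq x
    have hΨ : HasDerivAt Ψ (deriv Ψ ((1 - x ^ 2) / ε)) ((1 - x ^ 2) / ε) :=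
      (h.smooth.differentiable (by simp) _).hasDerivAt
    have := ((hs.rpow_const (p := b) (Or.inl hx.ne')).mul (q.hasDerivAt x)).mul
      (hΨ.comp x (hs.div_const ε))
    have e : (1 - x ^ 2) ^ b = (1 - x ^ 2) ^ (b - 1) * (1 - x ^ 2) := by
      rw [Real.rpow_sub_one hx.ne']; field_simp
    have h3 := this.deriv
    refine Eq.trans (b := _) ?_ (h3.trans ?_)
    · rfl
    · simp only [cutPow, Function.comp, Pi.mul_apply, eval_add, eval_sub, eval_mul, eval_C,
        eval_X, eval_pow, eval_one, e]
      field_simp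

/-- The class of functions `cutPow` is closed under differentiation up to sums, each derivative
lowering the exponent by one. No power of `ε` appears, so the bound is uniform in `ε`, as dominated
convergence requires. -/
theorem IsCutoff.iteratedDeriv_cutPow_bound (n : ℕ) :
    ∀ {Ψ : ℝ → ℝ} {L : ℝ} (_ : IsCutoff Ψ L) (b : ℝ) (q : ℝ[X]), ∃ K, ∀ ε > 0,
      ∀ x ∈ Ioo (-1 : ℝ) 1, |iteratedDeriv n (cutPow b q Ψ ε) x| ≤ K * (1 - x ^ 2) ^ (b - n) := by
  induction n with
  | zero =>
    intro Ψ L h b q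
    obtain ⟨K, hK⟩ := h.bounded
    obtain ⟨M, hM⟩ := isCompact_Icc.exists_bound_of_continuousOn (s := Icc (-1 : ℝ) 1)
      q.continuous.continuousOn
    refine ⟨M * K, fun ε _ x hx => ?_⟩
    have h1 := hM x (Ioo_subset_Icc_self hx)
    have h2 := hK ((1 - x ^ 2) / ε)
    have h3 := Real.rpow_pos_of_pos (one_sub_sq_pos hx) b
    have h4 : |q.eval x| * |Ψ ((1 - x ^ 2) / ε)| ≤ M * K :=
      mul_le_mul h1 h2 (abs_nonneg _) ((abs_nonneg _).trans h1)
    rw [iteratedDeriv_zero, cutPow, abs_mul, abs_mul, abs_of_pos h3]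
    simp only [Nat.cast_zero, sub_zero]
    nlinarith
  | succ n ih =>
    intro Ψ L h b q
    obtain ⟨K₁, hK₁⟩ := ih h (b - 1) (C (-2 * b) * X * q + (1 - X ^ 2) * derivative q)
    obtain ⟨K₂, hK₂⟩ := ih h.mul_deriv (b - 1) (C (-2) * X * q)
    refine ⟨K₁ + K₂, fun ε hε x hx => ?_⟩
    rw [iteratedDeriv_succ', h.deriv_cutPow b q hε, iteratedDeriv_add
      (((h.contDiff_cutPow _ _ hε).of_le (by exact_mod_cast le_top)).contDiffAt)
      (((h.mul_deriv.contDiff_cutPow _ _ hε).of_le (by exact_mod_cast le_top)).contDiffAt)]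
    refine (abs_add_le _ _).trans ?_
    have e : b - ((n + 1 : ℕ) : ℝ) = b - 1 - n := by push_cast; ring
    rw [e, add_mul]
    exact add_le_add (hK₁ ε hε x hx) (hK₂ ε hε x hx)

theorem IsCutoff.tendsto_iteratedDeriv_cutPow {Ψ : ℝ → ℝ} (h : IsCutoff Ψ 1) (b : ℝ) (q : ℝ[X])
    (n : ℕ) {x : ℝ} (hx : x ∈ Ioo (-1 : ℝ) 1) {e : ℕ → ℝ} (he : Tendsto e atTop (𝓝 0))
    (he0 : ∀ k, 0 < e k) :
    Tendsto (fun k => iteratedDeriv n (cutPow b q Ψ (e k)) x) atTop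
      (𝓝 (iteratedDeriv n (fun x : ℝ => (1 - x ^ 2) ^ b * q.eval x) x)) := by
  have hs := one_sub_sq_pos hx
  apply tendsto_const_nhds.congr'
  filter_upwards [he.eventually (Iio_mem_nhds (show 0 < (1 - x ^ 2) / 2 by linarith))] with k hk
  symm
  apply Filter.EventuallyEq.iteratedDeriv_eq
  have hc : Continuous fun x : ℝ => 1 - x ^ 2 := by fun_prop
  -- Near `x` the argument of the cutoff is then at least `2`, so the cutoff function equals `1` on
  -- a whole neighbourhood and all derivatives agree.
  have hk' : 2 * e k < 1 - x ^ 2 := by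
    have : e k < (1 - x ^ 2) / 2 := hk
    linarith
  filter_upwards [hc.continuousAt.preimage_mem_nhds (Ioi_mem_nhds hk')] with y hy
  rw [cutPow, h.const, mul_one]
  rw [le_div_iff₀ (he0 k)]; exact le_of_lt hy

theorem IsCutoff.tendsto_integral_iteratedDeriv_cutPow {Ψ : ℝ → ℝ} (h : IsCutoff Ψ 1) (b : ℝ)
    (q : ℝ[X]) (i : ℕ) {e : ℕ → ℝ} (he : Tendsto e atTop (𝓝 0)) (he0 : ∀ k, 0 < e k) {f : ℝ → ℝ}
    (hfm : AEStronglyMeasurable f (volume.restrict (Ioo (-1 : ℝ) 1)))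
    (hfi : IntegrableOn (fun x => f x * (1 - x ^ 2) ^ (b - i)) (Ioo (-1 : ℝ) 1)) :
    Tendsto (fun k => ∫ x in Ioo (-1 : ℝ) 1, f x * iteratedDeriv i (cutPow b q Ψ (e k)) x) atTop
      (𝓝 (∫ x in Ioo (-1 : ℝ) 1,
        f x * iteratedDeriv i (fun x => (1 - x ^ 2) ^ b * q.eval x) x)) := by
  obtain ⟨K, hK⟩ := IsCutoff.iteratedDeriv_cutPow_bound i h b q
  apply tendsto_integral_of_dominated_convergence
    (fun x => K * |f x * (1 - x ^ 2) ^ (b - i)|)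
  · intro k
    exact hfm.mul ((h.contDiff_cutPow b q (he0 k)).continuous_iteratedDeriv i
      (by exact_mod_cast le_top)).aestronglyMeasurable
  · exact hfi.abs.const_mul K
  · intro k
    filter_upwards [ae_restrict_mem measurableSet_Ioo] with x hx
    have h1 := hK (e k) (he0 k) x hx
    rw [Real.norm_eq_abs, abs_mul, abs_mul,
      abs_of_pos (Real.rpow_pos_of_pos (one_sub_sq_pos hx) (b - i))]
    nlinarith [abs_nonneg (f x)]
  · filter_upwards [ae_restrict_mem measurableSet_Ioo] with x hx
    exact (h.tendsto_iteratedDeriv_cutPow b q i hx he he0).const_mul (f x)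

/-! ### Differentiating weighted derivatives of zonal polynomials -/

/-- `∏_{i<n} (l-i)(l+d-2+i)`. -/
def eig (d l n : ℕ) : ℝ := ∏ i ∈ Finset.range n, (((l : ℝ) - i) * (l + d - 2 + i))

/-- The `j`-th derivative of the zonal polynomial. -/
def zder (d l j : ℕ) : ℝ[X] := derivative^[j] (zpoly d l)

/-- This is the divergence form of the equation satisfied by the `j`-th derivative: `w_{j+1}` is the
integrating factor. -/
theorem hasDerivAt_weight_mul_zder (d l j : ℕ) {x : ℝ} (hx : x ∈ Ioo (-1 : ℝ) 1) :
    HasDerivAt (fun x => weight d (j + 1) x * (zder d l (j + 1)).eval x)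
      (-((l - j) * (l + d - 2 + j)) * (weight d j x * (zder d l j).eval x)) x := by
  have hpos := one_sub_sq_pos hx
  have hs := hasDerivAt_one_sub_sq x
  have := (hs.rpow_const (p := ((d : ℝ) - 3) / 2 + ((j + 1 : ℕ) : ℝ)) (Or.inl hpos.ne')).mul
    ((zder d l (j + 1)).hasDerivAt x)
  refine this.congr_deriv ?_
  have hg := congrArg (Polynomial.eval x) (isGeg_iterate_zpoly d l j)
  have e1 : derivative (derivative^[j] (zpoly d l)) = zder d l (j + 1) := by
    rw [zder, Function.iterate_succ_apply']
  rw [e1] at hg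
  simp only [eval_add, eval_sub, eval_mul, eval_C, eval_one, eval_pow, eval_X, eval_zero] at hg
  have e2 : ((d : ℝ) - 3) / 2 + ((j + 1 : ℕ) : ℝ) - 1 = ((d : ℝ) - 3) / 2 + j := by
    push_cast; ring
  have e3 : (1 - x ^ 2) ^ (((d : ℝ) - 3) / 2 + ((j + 1 : ℕ) : ℝ))
      = (1 - x ^ 2) ^ (((d : ℝ) - 3) / 2 + j) * (1 - x ^ 2) := by
    rw [← e2, Real.rpow_sub_one hpos.ne']; field_simp
  have e4 : derivative^[j] (zpoly d l) = zder d l j := rfl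
  rw [e4] at hg
  rw [e2, e3, weight]
  push_cast
  linear_combination (1 - x ^ 2) ^ (((d : ℝ) - 3) / 2 + j) * hg

theorem iteratedDeriv_weight_mul_zder (d l n : ℕ) :
    ∀ {x : ℝ}, x ∈ Ioo (-1 : ℝ) 1 →
    iteratedDeriv n (fun x => weight d n x * (zder d l n).eval x) x
      = (-1) ^ n * (eig d l n * (weight d 0 x * (zpoly d l).eval x)) := by
  induction n with
  | zero => intro x hx; simp [eig, zder]
  | succ n ih =>
    intro x hx
    rw [iteratedDeriv_succ']
    have : deriv (fun x => weight d (n + 1) x * (zder d l (n + 1)).eval x) =ᶠ[𝓝 x]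
        fun x => -((l - n) * (l + d - 2 + n)) * (weight d n x * (zder d l n).eval x) := by
      filter_upwards [Ioo_mem_nhds hx.1 hx.2] with y hy
        using (hasDerivAt_weight_mul_zder d l n hy).deriv
    have hcd : ContDiffAt ℝ n (fun x => weight d n x * (zder d l n).eval x) x := by
      have hs : ContDiffAt ℝ n (fun x : ℝ => 1 - x ^ 2) x := by fun_prop
      exact (hs.rpow_const_of_ne (one_sub_sq_pos hx).ne').mul (contDiff_eval (zder d l n)).contDiffAt
    rw [this.iteratedDeriv_eq, iteratedDeriv_const_mul_field, ih hx, eig, eig,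
      Finset.prod_range_succ]
    ring

/-- Passing the weak derivative to the zonal polynomial: no boundary terms appear. -/
theorem HasWeakDeriv.integral_zder {d n : ℕ} (l : ℕ) {u v : ℝ → ℝ} (h : HasWeakDeriv n u v)
    (hu : IntegrableOn (fun x => u x * weight d 0 x) (Ioo (-1 : ℝ) 1))
    (hv : IntegrableOn (fun x => v x * weight d n x) (Ioo (-1 : ℝ) 1)) :
    ∫ x in Ioo (-1 : ℝ) 1, v x * weight d n x * (zder d l n).eval x
      = eig d l n * ∫ x in Ioo (-1 : ℝ) 1, u x * weight d 0 x * (zpoly d l).eval x := by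
  set e : ℕ → ℝ := fun k => 1 / ((k : ℝ) + 1) with he
  have he0 : ∀ k, 0 < e k := fun k => by positivity
  have het : Tendsto e atTop (𝓝 0) := tendsto_one_div_add_atTop_nhds_zero_nat
  have hΨ := isCutoff_smoothTransition
  set Ψ : ℝ → ℝ := fun t => Real.smoothTransition (t - 1)
  set b : ℝ := ((d : ℝ) - 3) / 2 + n with hb
  have hmeas : MeasurableSet (Ioo (-1 : ℝ) 1) := measurableSet_Ioo
  have hum : AEStronglyMeasurable u (volume.restrict (Ioo (-1 : ℝ) 1)) :=
    h.1.aestronglyMeasurable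
  have hvm : AEStronglyMeasurable v (volume.restrict (Ioo (-1 : ℝ) 1)) :=
    h.2.1.aestronglyMeasurable
  have hsm : ∀ k, ContDiff ℝ (⊤ : ℕ∞) (cutPow b (zder d l n) Ψ (e k)) :=
    fun k => hΨ.contDiff_cutPow _ _ (he0 k)
  have key : ∀ k, ∫ x in Ioo (-1 : ℝ) 1, u x * iteratedDeriv n (cutPow b (zder d l n) Ψ (e k)) x
      = (-1) ^ n * ∫ x in Ioo (-1 : ℝ) 1, v x * iteratedDeriv 0 (cutPow b (zder d l n) Ψ (e k)) x :=
    fun k => by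
      simpa using h.2.2 _ (hsm k)
        (hasCompactSupport_of_tsupport_subset_Ioo (hΨ.tsupport_cutPow _ _ (he0 k)))
        (hΨ.tsupport_cutPow _ _ (he0 k))
  -- The `n` derivatives cost `n` powers of `1-x²`, turning `w_n` into `w_0`; the dominating
  -- function is then a multiple of `|u| w_0`. On the other side no derivative is taken and `|v|
  -- w_n` dominates.
  have l1 := hΨ.tendsto_integral_iteratedDeriv_cutPow b (zder d l n) n het he0 hum (by
    refine hu.congr_fun (fun x _ => ?_) hmeas
    simp [weight, hb])
  have l2 := (hΨ.tendsto_integral_iteratedDeriv_cutPow b (zder d l n) 0 het he0 hvm (by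
    refine hv.congr_fun (fun x _ => ?_) hmeas
    simp [weight, hb])).const_mul ((-1 : ℝ) ^ n)
  have heq := tendsto_nhds_unique l1 (l2.congr fun k => (key k).symm)
  have e1 : ∫ x in Ioo (-1 : ℝ) 1,
        u x * iteratedDeriv n (fun x => (1 - x ^ 2) ^ b * (zder d l n).eval x) x
      = (-1) ^ n * (eig d l n *
        ∫ x in Ioo (-1 : ℝ) 1, u x * weight d 0 x * (zpoly d l).eval x) := by
    rw [← integral_const_mul, ← integral_const_mul]
    refine setIntegral_congr_fun hmeas fun x hx => ?_
    have := iteratedDeriv_weight_mul_zder d l n hx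
    simp only [weight] at this ⊢
    rw [← hb] at this
    simp only [this]
    ring
  have e2 : ∫ x in Ioo (-1 : ℝ) 1,
        v x * iteratedDeriv 0 (fun x => (1 - x ^ 2) ^ b * (zder d l n).eval x) x
      = ∫ x in Ioo (-1 : ℝ) 1, v x * weight d n x * (zder d l n).eval x := by
    refine setIntegral_congr_fun hmeas fun x hx => ?_
    simp only [iteratedDeriv_zero, weight, hb]; ring
  rw [e1, e2] at heq
  exact (mul_left_cancel₀ (pow_ne_zero n (by norm_num)) heq).symm

/-! ### The weighted measures -/

theorem weight_pos (d j : ℕ) {x : ℝ} (hx : x ∈ Ioo (-1 : ℝ) 1) : 0 < weight d j x :=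
  Real.rpow_pos_of_pos (one_sub_sq_pos hx) _

theorem measurable_weight (d j : ℕ) : Measurable (weight d j) := by
  unfold weight; fun_prop

theorem continuousOn_weight (d j : ℕ) : ContinuousOn (weight d j) (Ioo (-1 : ℝ) 1) := by
  unfold weight
  exact ContinuousOn.rpow_const (by fun_prop) fun x hx => Or.inl (one_sub_sq_pos hx).ne'

/-- The exponent is at least `-1/2`, so the weight lies below the arcsine density. -/
theorem integrableOn_weight {d : ℕ} (hd : 2 ≤ d) (j : ℕ) :
    IntegrableOn (weight d j) (Ioo (-1 : ℝ) 1) := by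
  have hd' : (2 : ℝ) ≤ d := by exact_mod_cast hd
  have h := Polynomial.Chebyshev.intervalIntegrable_sqrt_one_sub_sq_inv
  rw [intervalIntegrable_iff, Set.uIoc_of_le (by norm_num), integrableOn_Ioc_iff_integrableOn_Ioo]
    at h
  refine Integrable.mono' h (measurable_weight d j).aestronglyMeasurable ?_
  filter_upwards [ae_restrict_mem measurableSet_Ioo] with x hx
  have hp := one_sub_sq_pos hx
  rw [Real.norm_eq_abs, abs_of_pos (weight_pos d j hx), Real.sqrt_eq_rpow, Real.inv_rpow hp.le,
    ← Real.rpow_neg hp.le]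
  refine Real.rpow_le_rpow_of_exponent_ge hp (by nlinarith) ?_
  have : (0 : ℝ) ≤ j := by positivity
  linarith

/-- The measure with density `weight d j` on `(-1,1)`. -/
def wm (d j : ℕ) : Measure ℝ :=
  (volume.restrict (Ioo (-1 : ℝ) 1)).withDensity fun x => ENNReal.ofReal (weight d j x)

theorem isFiniteMeasure_wm {d : ℕ} (hd : 2 ≤ d) (j : ℕ) : IsFiniteMeasure (wm d j) :=
  isFiniteMeasure_withDensity_ofReal (integrableOn_weight hd j).2

theorem integral_wm (d j : ℕ) (f : ℝ → ℝ) :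
    ∫ x, f x ∂wm d j = ∫ x in Ioo (-1 : ℝ) 1, f x * weight d j x := by
  rw [wm, integral_withDensity_eq_integral_toReal_smul (measurable_weight d j).ennreal_ofReal
    (by simp)]
  refine setIntegral_congr_fun measurableSet_Ioo fun x hx => ?_
  simp only [ENNReal.toReal_ofReal (weight_pos d j hx).le, smul_eq_mul, mul_comm]

theorem integrable_wm_iff {d j : ℕ} {f : ℝ → ℝ} :
    Integrable f (wm d j) ↔ IntegrableOn (fun x => f x * weight d j x) (Ioo (-1 : ℝ) 1) := by
  rw [wm, integrable_withDensity_iff (measurable_weight d j).ennreal_ofReal (by simp)]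
  refine integrableOn_congr_fun (fun x hx => ?_) measurableSet_Ioo
  simp only [ENNReal.toReal_ofReal (weight_pos d j hx).le]

/-- The weight is positive on the open interval, so all these measures have the same null sets as
Lebesgue measure there. -/
theorem ae_wm (d j : ℕ) : ae (wm d j) = ae (volume.restrict (Ioo (-1 : ℝ) 1)) := by
  apply le_antisymm
  · exact (withDensity_absolutelyContinuous _ _).ae_le
  · refine (withDensity_absolutelyContinuous'
      (measurable_weight d j).ennreal_ofReal.aemeasurable ?_).ae_le
    filter_upwards [ae_restrict_mem measurableSet_Ioo] with x hx
    simpa using weight_pos d j hx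

theorem aestronglyMeasurable_wm_iff {d j : ℕ} {f : ℝ → ℝ} :
    AEStronglyMeasurable f (wm d j)
      ↔ AEStronglyMeasurable f (volume.restrict (Ioo (-1 : ℝ) 1)) := by
  constructor <;> rintro ⟨g, hg, h⟩ <;> refine ⟨g, hg, ?_⟩
  · rwa [EventuallyEq, ← ae_wm d j]
  · rwa [EventuallyEq, ae_wm d j]

theorem ae_wm_mem (d j : ℕ) : ∀ᵐ x ∂wm d j, x ∈ Ioo (-1 : ℝ) 1 := by
  rw [ae_wm]; exact ae_restrict_mem measurableSet_Ioo

theorem polynomial_bounded (q : ℝ[X]) : ∃ K, ∀ x ∈ Icc (-1 : ℝ) 1, |q.eval x| ≤ K :=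
  isCompact_Icc.exists_bound_of_continuousOn q.continuous.continuousOn

theorem memLp_polynomial {d : ℕ} (hd : 2 ≤ d) (j : ℕ) (q : ℝ[X]) :
    MemLp (fun x => q.eval x) 2 (wm d j) := by
  have := isFiniteMeasure_wm hd j
  obtain ⟨K, hK⟩ := polynomial_bounded q
  refine MemLp.of_bound q.continuous.aestronglyMeasurable K ?_
  filter_upwards [ae_wm_mem d j] with x hx using hK x (Ioo_subset_Icc_self hx)

theorem integrable_mul_polynomial {d j : ℕ} {f : ℝ → ℝ} (hf : Integrable f (wm d j))
    (q : ℝ[X]) : Integrable (fun x => f x * q.eval x) (wm d j) := by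
  obtain ⟨K, hK⟩ := polynomial_bounded q
  refine hf.mul_bdd (c := K) q.continuous.aestronglyMeasurable ?_
  filter_upwards [ae_wm_mem d j] with x hx using hK x (Ioo_subset_Icc_self hx)

theorem integrable_polynomial {d : ℕ} (hd : 2 ≤ d) (j : ℕ) (q : ℝ[X]) :
    Integrable (fun x => q.eval x) (wm d j) := by
  have := isFiniteMeasure_wm hd j
  exact (memLp_polynomial hd j q).integrable one_le_two

/-- Integration against `f` as a linear functional on polynomials. -/
def polyFunctional (d j : ℕ) (f : ℝ → ℝ) (hf : Integrable f (wm d j)) : ℝ[X] →ₗ[ℝ] ℝ where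
  toFun q := ∫ x, f x * q.eval x ∂wm d j
  map_add' p q := by
    simp only [eval_add, mul_add]
    exact integral_add (integrable_mul_polynomial hf p) (integrable_mul_polynomial hf q)
  map_smul' c q := by
    simp only [eval_smul, smul_eq_mul, RingHom.id_apply]
    rw [← integral_const_mul]
    congr 1; funext x; ring

/-- One polynomial in each degree spans everything: the leading term is removed by a multiple of `p
k`, and the degree drops. -/
theorem linearMap_eq_zero_of_natDegree {p : ℕ → ℝ[X]} (hp : ∀ m, p m ≠ 0)
    (hdeg : ∀ m, (p m).natDegree = m) (Λ : ℝ[X] →ₗ[ℝ] ℝ) (k : ℕ) (h : ∀ m < k, Λ (p m) = 0)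
    (q : ℝ[X]) (hq : q.degree < k) : Λ q = 0 := by
  induction k generalizing q with
  | zero =>
    have : q = 0 := by simpa [Nat.WithBot.lt_zero_iff] using hq
    simp [this]
  | succ k ih =>
    have hlc : (p k).coeff k ≠ 0 := by
      have := leadingCoeff_ne_zero.mpr (hp k)
      rwa [leadingCoeff, hdeg] at this
    set r := q - (q.coeff k / (p k).coeff k) • p k with hr
    have hrd : r.degree < k := by
      rw [degree_lt_iff_coeff_zero] at hq ⊢
      intro m hm
      rcases hm.eq_or_lt with rfl | hlt
      · simp [hr, div_mul_cancel₀ _ hlc]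
      · rw [hr, coeff_sub, coeff_smul, hq m hlt,
          coeff_eq_zero_of_natDegree_lt (show (p k).natDegree < m by rw [hdeg]; exact hlt)]
        simp
    have h1 := ih (fun m hm => h m (by omega)) r hrd
    rw [hr, map_sub, map_smul, h k (by omega)] at h1
    simpa using h1

/-- Weierstrass approximation transfers the vanishing from polynomials to smooth test functions,
with error at most `ε ∫ |g|`. Only integrability of `g` is needed, so uniqueness holds in `L^1`. -/
theorem ae_eq_zero_of_integral_polynomial {g : ℝ → ℝ} (hg : IntegrableOn g (Ioo (-1 : ℝ) 1))
    (h : ∀ q : ℝ[X], ∫ x in Ioo (-1 : ℝ) 1, g x * q.eval x = 0) :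
    g =ᵐ[volume.restrict (Ioo (-1 : ℝ) 1)] 0 := by
  have := IsOpen.ae_eq_zero_of_integral_contDiff_smul_eq_zero (U := Ioo (-1 : ℝ) 1) (f := g)
    (μ := volume) isOpen_Ioo hg.locallyIntegrableOn ?_
  · rw [EventuallyEq, ae_restrict_iff' measurableSet_Ioo]
    exact this
  · intro φ hφ _ hsupp
    have e : ∫ x, φ x • g x = ∫ x in Ioo (-1 : ℝ) 1, φ x * g x := by
      rw [setIntegral_eq_integral_of_forall_compl_eq_zero]
      · rfl
      · intro x hx
        rw [image_eq_zero_of_notMem_tsupport (fun h => hx (hsupp h)), zero_mul]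
    rw [e]
    set M := ∫ x in Ioo (-1 : ℝ) 1, |g x| with hM
    have hM0 : 0 ≤ M := integral_nonneg fun x => abs_nonneg _
    have hb : ∀ ε > 0, |∫ x in Ioo (-1 : ℝ) 1, φ x * g x| ≤ ε * M := by
      intro ε hε
      obtain ⟨p, hp⟩ := exists_polynomial_near_of_continuousOn (-1) 1 φ
        hφ.continuous.continuousOn ε hε
      obtain ⟨K, hK⟩ := polynomial_bounded p
      have hi1 : IntegrableOn (fun x => g x * p.eval x) (Ioo (-1 : ℝ) 1) := by
        refine hg.mul_bdd (c := K) p.continuous.aestronglyMeasurable ?_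
        filter_upwards [ae_restrict_mem measurableSet_Ioo] with x hx
          using hK x (Ioo_subset_Icc_self hx)
      have hi2 : IntegrableOn (fun x => (φ x - p.eval x) * g x) (Ioo (-1 : ℝ) 1) := by
        refine hg.bdd_mul (c := ε)
          (hφ.continuous.sub p.continuous).aestronglyMeasurable ?_
        filter_upwards [ae_restrict_mem measurableSet_Ioo] with x hx
        rw [Real.norm_eq_abs, abs_sub_comm]
        exact (hp x (Ioo_subset_Icc_self hx)).le
      have e2 : ∫ x in Ioo (-1 : ℝ) 1, φ x * g x
          = ∫ x in Ioo (-1 : ℝ) 1, (φ x - p.eval x) * g x := by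
        rw [← add_zero (∫ x in Ioo (-1 : ℝ) 1, (φ x - p.eval x) * g x), ← h p,
          ← integral_add hi2 hi1]
        congr 1; funext x; ring
      rw [e2, hM, ← integral_const_mul]
      refine (abs_integral_le_integral_abs).trans ?_
      refine integral_mono_ae hi2.abs (hg.abs.const_mul ε) ?_
      filter_upwards [ae_restrict_mem measurableSet_Ioo] with x hx
      rw [abs_mul]
      refine mul_le_mul_of_nonneg_right ?_ (abs_nonneg _)
      rw [abs_sub_comm]
      exact (hp x (Ioo_subset_Icc_self hx)).le
    have : |∫ x in Ioo (-1 : ℝ) 1, φ x * g x| ≤ 0 := by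
      refine le_of_forall_pos_le_add fun ε hε => ?_
      refine (hb (ε / (M + 1)) (by positivity)).trans ?_
      rw [zero_add, div_mul_eq_mul_div, div_le_iff₀ (by positivity)]
      nlinarith
    exact abs_eq_zero.mp (le_antisymm this (abs_nonneg _))

/-- Zonal derivatives are complete in `L^1`. -/
theorem ae_eq_zero_of_integral_zder {d j : ℕ} (hd : 2 ≤ d) {f : ℝ → ℝ}
    (hf : Integrable f (wm d j)) (h : ∀ l, j ≤ l → ∫ x, f x * (zder d l j).eval x ∂wm d j = 0) :
    f =ᵐ[volume.restrict (Ioo (-1 : ℝ) 1)] 0 := by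
  -- The `j`-th derivative of `Q_{m+j}` has exact degree `m`, so these derivatives span all
  -- polynomials.
  have hcoeff : ∀ m, (zder d (m + j) j).coeff m ≠ 0 := by
    intro m
    rw [zder, coeff_iterate_derivative]
    have : (zpoly d (m + j)).coeff (m + j) ≠ 0 := by
      have := leadingCoeff_ne_zero.mpr (zpoly_ne_zero hd (m + j))
      rwa [leadingCoeff, zpoly_natDegree hd] at this
    have h2 : (m + j).descFactorial j ≠ 0 := by
      rw [Ne, Nat.descFactorial_eq_zero_iff_lt]; omega
    rw [nsmul_eq_mul]
    exact mul_ne_zero (by exact_mod_cast h2) this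
  have hdeg : ∀ m, (zder d (m + j) j).natDegree = m := fun m =>
    le_antisymm ((natDegree_iterate_derivative _ _).trans (by rw [zpoly_natDegree hd]; omega))
      (le_natDegree_of_ne_zero (hcoeff m))
  have hne : ∀ m, zder d (m + j) j ≠ 0 := by
    intro m h0
    apply hcoeff m
    simp [h0]
  have hz : ∀ q : ℝ[X], ∫ x, f x * q.eval x ∂wm d j = 0 := by
    intro q
    exact linearMap_eq_zero_of_natDegree hne hdeg (polyFunctional d j f hf) (q.natDegree + 1)
      (fun m _ => h (m + j) (by omega)) q
      (lt_of_le_of_lt degree_le_natDegree (by exact_mod_cast Nat.lt_succ_self _))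
  have h2 := ae_eq_zero_of_integral_polynomial (integrable_wm_iff.mp hf) (fun q => by
    rw [← hz q, integral_wm]
    congr 1; funext x; ring)
  filter_upwards [h2, ae_restrict_mem measurableSet_Ioo] with x h3 hx
  exact (mul_eq_zero.mp h3).resolve_right (weight_pos d j hx).ne'

/-! ### Weak derivatives of polynomials -/

theorem integral_polynomial_mul_iteratedDeriv (n : ℕ) : ∀ (q : ℝ[X]) (φ : ℝ → ℝ),
    ContDiff ℝ (⊤ : ℕ∞) φ → tsupport φ ⊆ Ioo (-1 : ℝ) 1 →
      ∫ x in Ioo (-1 : ℝ) 1, q.eval x * iteratedDeriv n φ x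
        = (-1) ^ n * ∫ x in Ioo (-1 : ℝ) 1, (derivative^[n] q).eval x * φ x := by
  induction n with
  | zero => intro q φ _ _; simp
  | succ n ih =>
    intro q φ hφ hs
    have hφ' := (contDiff_infty_iff_deriv.mp hφ).2
    have hs' : tsupport (deriv φ) ⊆ Ioo (-1 : ℝ) 1 := tsupport_deriv_subset.trans hs
    have hc := hasCompactSupport_of_tsupport_subset_Ioo hs
    have hc' := hasCompactSupport_of_tsupport_subset_Ioo hs'
    rw [iteratedDeriv_succ', ih q _ hφ' hs']
    set r := derivative^[n] q with hr
    have e1 : ∫ x in Ioo (-1 : ℝ) 1, r.eval x * deriv φ x = ∫ x, r.eval x * deriv φ x :=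
      setIntegral_eq_integral_of_forall_compl_eq_zero fun x hx => by
        rw [image_eq_zero_of_notMem_tsupport (fun h => hx (hs' h)), mul_zero]
    have e2 : ∫ x in Ioo (-1 : ℝ) 1, (derivative r).eval x * φ x
        = ∫ x, (derivative r).eval x * φ x :=
      setIntegral_eq_integral_of_forall_compl_eq_zero fun x hx => by
        rw [image_eq_zero_of_notMem_tsupport (fun h => hx (hs h)), mul_zero]
    have e3 := integral_mul_deriv_eq_deriv_mul_of_integrable (u := fun x => r.eval x) (v := φ)
      (u' := fun x => (derivative r).eval x) (v' := deriv φ)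
      (fun x _ => r.hasDerivAt x) (fun x _ => (hφ.differentiable (by simp) x).hasDerivAt)
      ((r.continuous.mul hφ'.continuous).integrable_of_hasCompactSupport hc'.mul_left)
      (((derivative r).continuous.mul hφ.continuous).integrable_of_hasCompactSupport hc.mul_left)
      ((r.continuous.mul hφ.continuous).integrable_of_hasCompactSupport hc.mul_left)
    rw [Function.iterate_succ_apply', ← hr, e1, e2, e3]
    ring

theorem hasWeakDeriv_polynomial (n : ℕ) (q : ℝ[X]) :
    HasWeakDeriv n (fun x => q.eval x) (fun x => (derivative^[n] q).eval x) :=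
  ⟨q.continuous.locallyIntegrable.locallyIntegrableOn _,
    (derivative^[n] q).continuous.locallyIntegrable.locallyIntegrableOn _,
    fun φ hφ _ hs => integral_polynomial_mul_iteratedDeriv n q φ hφ hs⟩

/-! ### Orthogonality -/

theorem HasWeakDeriv.integral_wm_zder {d n : ℕ} (l : ℕ) {u v : ℝ → ℝ} (h : HasWeakDeriv n u v)
    (hu : Integrable u (wm d 0)) (hv : Integrable v (wm d n)) :
    ∫ x, v x * (zder d l n).eval x ∂wm d n
      = eig d l n * ∫ x, u x * (zpoly d l).eval x ∂wm d 0 := by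
  rw [integral_wm, integral_wm]
  have := h.integral_zder l (integrable_wm_iff.mp hu) (integrable_wm_iff.mp hv)
  simp only [mul_right_comm _ _ (weight _ _ _)] at this ⊢
  exact this

/-- The squared norm of the zonal polynomial. -/
def znorm (d l : ℕ) : ℝ := ∫ x, (zpoly d l).eval x * (zpoly d l).eval x ∂wm d 0

theorem integral_zder_mul_zder {d : ℕ} (hd : 2 ≤ d) (m l n : ℕ) :
    ∫ x, (zder d m n).eval x * (zder d l n).eval x ∂wm d n
      = eig d l n * ∫ x, (zpoly d m).eval x * (zpoly d l).eval x ∂wm d 0 :=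
  (hasWeakDeriv_polynomial n (zpoly d m)).integral_wm_zder l (integrable_polynomial hd 0 _)
    (integrable_polynomial hd n _)

theorem eig_one (d l : ℕ) : eig d l 1 = l * (l + d - 2) := by simp [eig]

/-- The symmetric integral of `Q_m' Q_l'` against `w_1` equals the integral of `Q_m Q_l` times
either eigenvalue. The eigenvalues differ. -/
theorem integral_zpoly_mul_zpoly_of_ne {d : ℕ} (hd : 2 ≤ d) {m l : ℕ} (h : m ≠ l) :
    ∫ x, (zpoly d m).eval x * (zpoly d l).eval x ∂wm d 0 = 0 := by
  have h1 := integral_zder_mul_zder hd m l 1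
  have h2 := integral_zder_mul_zder hd l m 1
  simp only [mul_comm ((zder d l 1).eval _), mul_comm ((zpoly d l).eval _)] at h2
  rw [h1, eig_one, eig_one] at h2
  have hd' : (2 : ℝ) ≤ d := by exact_mod_cast hd
  have hm : (0 : ℝ) ≤ m := by positivity
  have hl : (0 : ℝ) ≤ l := by positivity
  have h3 : ((l : ℝ) - m) * (l + m + d - 2)
      * ∫ x, (zpoly d m).eval x * (zpoly d l).eval x ∂wm d 0 = 0 := by linear_combination h2
  refine (mul_eq_zero.mp h3).resolve_left (mul_ne_zero ?_ ?_)
  · rw [sub_ne_zero]; exact_mod_cast h.symm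
  · rcases Nat.lt_or_gt_of_ne h with h4 | h4
    · have : (1 : ℝ) ≤ l := by exact_mod_cast (by omega : 1 ≤ l)
      linarith
    · have : (1 : ℝ) ≤ m := by exact_mod_cast (by omega : 1 ≤ m)
      linarith

theorem integral_zder_mul_zder_of_ne {d : ℕ} (hd : 2 ≤ d) {m l : ℕ} (h : m ≠ l) (n : ℕ) :
    ∫ x, (zder d m n).eval x * (zder d l n).eval x ∂wm d n = 0 := by
  rw [integral_zder_mul_zder hd, integral_zpoly_mul_zpoly_of_ne hd h, mul_zero]

theorem integral_zder_mul_self {d : ℕ} (hd : 2 ≤ d) (l n : ℕ) :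
    ∫ x, (zder d l n).eval x * (zder d l n).eval x ∂wm d n = eig d l n * znorm d l :=
  integral_zder_mul_zder hd l l n

/-! ### Norms of zonal polynomials and dimensions of harmonics -/

theorem weight_succ (d j : ℕ) : weight d (j + 1) = weight (d + 2) j := by
  funext x; unfold weight; congr 1; push_cast; ring

theorem wm_succ (d j : ℕ) : wm d (j + 1) = wm (d + 2) j := by
  unfold wm; rw [weight_succ]

/-- The norm of `Q_{l+1}'` in `L^2(w_1)` is computed twice: by integration by parts, and as a
multiple of a zonal polynomial of dimension `d + 2`, whose weight is the same `w_1`. -/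
theorem znorm_step {d : ℕ} (hd : 2 ≤ d) (l : ℕ) :
    ((l : ℝ) + 1) * (l + d - 1) * znorm (d + 2) l = ((d : ℝ) - 1) ^ 2 * znorm d (l + 1) := by
  have hd' : (2 : ℝ) ≤ d := by exact_mod_cast hd
  have hl : (0 : ℝ) ≤ l := by positivity
  have h := integral_zder_mul_self hd (l + 1) 1
  have e : zder d (l + 1) 1 = derivative (zpoly d (l + 1)) := rfl
  rw [e, derivative_zpoly_succ hd, wm_succ, eig_one] at h
  simp only [eval_mul, eval_C] at h
  have e2 : ∫ x, ((l : ℝ) + 1) * (l + d - 1) / (d - 1) * (zpoly (d + 2) l).eval x *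
      (((l : ℝ) + 1) * (l + d - 1) / (d - 1) * (zpoly (d + 2) l).eval x) ∂wm (d + 2) 0
      = (((l : ℝ) + 1) * (l + d - 1) / (d - 1)) ^ 2 * znorm (d + 2) l := by
    rw [znorm, ← integral_const_mul]; congr 1; funext x; ring
  rw [e2] at h
  have h1 : (d : ℝ) - 1 ≠ 0 := by linarith
  have h2 : (l : ℝ) + d - 1 ≠ 0 := by linarith
  have h3 : (l : ℝ) + 1 ≠ 0 := by linarith
  field_simp at h
  push_cast at h
  have h4 : (((l : ℝ) + 1) * (l + d - 1)) * (((l : ℝ) + 1) * (l + d - 1) * znorm (d + 2) l)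
      = (((l : ℝ) + 1) * (l + d - 1)) * (((d : ℝ) - 1) ^ 2 * znorm d (l + 1)) := by
    linear_combination h
  exact mul_left_cancel₀ (mul_ne_zero h3 h2) h4

/-- This recurrence carries the same `l`-dependent factor as `znorm_step`, which therefore cancels
in the product of norm and dimension. -/
theorem harmDim_step {d : ℕ} (hd : 2 ≤ d) (l : ℕ) :
    (d : ℝ) * (d - 1) * harmDim l (d + 2)
      = ((l : ℝ) + 1) * (l + d - 1) * harmDim (l + 1) d := by
  obtain ⟨e, rfl⟩ := Nat.exists_eq_add_of_le hd
  have e1 : l + 1 + (2 + e) - 3 = l + e := by omega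
  have e2 : l + (2 + e + 2) - 3 = l + e + 1 := by omega
  have e3 : 2 + e - 2 = e := by omega
  have e4 : 2 + e + 2 - 2 = e + 1 + 1 := by omega
  unfold harmDim
  rw [if_neg (Nat.succ_ne_zero l), e1, e2, e3, e4]
  simp only [Nat.factorial_succ]
  have f1 : (e.factorial : ℝ) ≠ 0 := by positivity
  have f2 : (l.factorial : ℝ) ≠ 0 := by positivity
  have f3 : (e : ℝ) + 1 ≠ 0 := by positivity
  have f4 : (e : ℝ) + 1 + 1 ≠ 0 := by positivity
  have f5 : (l : ℝ) + 1 ≠ 0 := by positivity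
  split_ifs with h
  · subst h
    push_cast
    simp only [Nat.factorial_zero, zero_add]
    field_simp
    push_cast
    ring
  · push_cast
    field_simp
    ring

theorem harmDim_two (l : ℕ) : harmDim l 2 = if l = 0 then 1 else 2 := by
  unfold harmDim
  split_ifs with h
  · rfl
  · obtain ⟨k, rfl⟩ := Nat.exists_eq_succ_of_ne_zero h
    have e1 : k.succ + 2 - 3 = k := by omega
    rw [e1]
    simp only [Nat.succ_eq_add_one, Nat.factorial_succ, Nat.sub_self, Nat.factorial_zero]
    have f2 : (k.factorial : ℝ) ≠ 0 := by positivity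
    have f5 : (k : ℝ) + 1 ≠ 0 := by positivity
    push_cast
    field_simp
    ring

theorem harmDim_three (l : ℕ) : harmDim l 3 = 2 * l + 1 := by
  unfold harmDim
  split_ifs with h
  · simp [h]
  · have f2 : (l.factorial : ℝ) ≠ 0 := by positivity
    simp
    field_simp
    ring

theorem znorm_two (l : ℕ) : znorm 2 l = if l = 0 then Real.pi else Real.pi / 2 := by
  have e : znorm 2 l = ∫ x, (Polynomial.Chebyshev.T ℝ l).eval x *
      (Polynomial.Chebyshev.T ℝ l).eval x ∂Polynomial.Chebyshev.measureT := by
    rw [Polynomial.Chebyshev.integral_measureT, intervalIntegral.integral_of_le (by norm_num),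
      integral_Ioc_eq_integral_Ioo, znorm, integral_wm]
    refine setIntegral_congr_fun measurableSet_Ioo fun x hx => ?_
    have hp := one_sub_sq_pos hx
    have e2 : weight 2 0 x = √(1 - x ^ 2)⁻¹ := by
      rw [Real.sqrt_eq_rpow, Real.inv_rpow hp.le, ← Real.rpow_neg hp.le, weight]
      norm_num
    simp only [e2, zpoly, if_pos]
  rw [e]
  split_ifs with h
  · subst h
    exact Polynomial.Chebyshev.integral_eval_T_real_mul_self_measureT_zero
  · exact Polynomial.Chebyshev.integral_T_real_mul_self_measureT_of_ne_zero h

/-- For `d = 3` the weight is `1`, and `(xQ²)' = (2l+1)Q² + 2Q(xQ' - lQ)`. The last bracket has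
degree below `l`, hence is orthogonal to `Q`, while the left side integrates to `2`. -/
theorem znorm_three (l : ℕ) : (2 * (l : ℝ) + 1) * znorm 3 l = 2 := by
  have hd : 2 ≤ 3 := by norm_num
  have hw : ∀ f : ℝ → ℝ, ∫ x, f x ∂wm 3 0 = ∫ x in (-1 : ℝ)..1, f x := by
    intro f
    rw [intervalIntegral.integral_of_le (by norm_num), integral_Ioc_eq_integral_Ioo, integral_wm]
    congr 1; funext x; simp [weight]
  set Q := zpoly 3 l with hQ
  have hortho : ∫ x, Q.eval x * (X * derivative Q - C (l : ℝ) * Q).eval x ∂wm 3 0 = 0 := by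
    refine linearMap_eq_zero_of_natDegree (p := zpoly 3) (zpoly_ne_zero hd) (zpoly_natDegree hd)
      (polyFunctional 3 0 _ (integrable_polynomial hd 0 Q)) l
      (fun m hm => integral_zpoly_mul_zpoly_of_ne hd hm.ne') _ ?_
    rw [degree_lt_iff_coeff_zero]
    intro m hm
    rw [coeff_sub, coeff_X_mul_derivative, coeff_C_mul, ← sub_mul]
    rcases hm.eq_or_lt with rfl | hlt
    · simp
    · rw [coeff_eq_zero_of_natDegree_lt (show Q.natDegree < m by
        rw [hQ, zpoly_natDegree hd]; exact hlt), mul_zero]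
  have hftc : ∫ x in (-1 : ℝ)..1, (derivative (X * Q ^ 2)).eval x = 2 := by
    rw [intervalIntegral.integral_eq_sub_of_hasDerivAt (f := fun x => (X * Q ^ 2).eval x)
      (fun x _ => Polynomial.hasDerivAt _ x) (Continuous.intervalIntegrable (by fun_prop) _ _)]
    simp only [eval_mul, eval_X, eval_pow, hQ, zpoly_eval_one hd, zpoly_eval_neg_one_sq hd]
    norm_num
  have e : derivative (X * Q ^ 2) = C (2 * (l : ℝ) + 1) * (Q * Q)
      + C 2 * (Q * (X * derivative Q - C (l : ℝ) * Q)) := by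
    simp only [derivative_mul, derivative_X, derivative_pow, C_add, C_mul, C_1]
    norm_num
    rw [show (C (2 : ℝ) : ℝ[X]) = 2 from map_ofNat C 2]
    ring
  rw [e, ← hw] at hftc
  simp only [eval_add, eval_mul (p := C _), eval_C] at hftc
  rw [integral_add ((integrable_polynomial hd 0 _).const_mul _)
    ((integrable_polynomial hd 0 _).const_mul _), integral_const_mul, integral_const_mul] at hftc
  simp only [eval_mul (p := Q)] at hftc
  rw [hortho, mul_zero, add_zero] at hftc
  exact hftc

/-- Both recurrences step from `d` to `d + 2`, so the induction starts from `d = 2` and `d = 3`.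
Each step multiplies the constant by `(d-1)/d`. -/
theorem exists_znorm_mul_harmDim {d : ℕ} (hd : 2 ≤ d) :
    ∃ κ : ℝ, 0 < κ ∧ ∀ l, znorm d l * harmDim l d = κ := by
  obtain ⟨e, rfl⟩ := Nat.exists_eq_add_of_le hd
  clear hd
  induction e using Nat.twoStepInduction with
  | zero =>
    refine ⟨Real.pi, Real.pi_pos, fun l => ?_⟩
    rw [Nat.add_zero, znorm_two, harmDim_two]
    split_ifs <;> ring
  | one =>
    refine ⟨2, two_pos, fun l => ?_⟩
    rw [harmDim_three, mul_comm]
    exact znorm_three l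
  | more e ih _ =>
    obtain ⟨κ, hκ, h⟩ := ih
    have hd : 2 ≤ 2 + e := by omega
    have hd' : (2 : ℝ) ≤ ((2 + e : ℕ) : ℝ) := by exact_mod_cast hd
    rw [← add_assoc]
    set d := 2 + e
    have h1 : 0 < (d : ℝ) - 1 := by linarith
    have h0 : 0 < (d : ℝ) := by linarith
    refine ⟨(d - 1) / d * κ, by positivity, fun l => ?_⟩
    have hz := znorm_step hd l
    have hh := harmDim_step hd l
    have hl : (0 : ℝ) ≤ l := by positivity
    have h2 : 0 < (l : ℝ) + d - 1 := by linarith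
    have h3 : 0 < (l : ℝ) + 1 := by linarith
    have h4 : (((l : ℝ) + 1) * (l + d - 1) * (d - 1)) * (d * (znorm (d + 2) l * harmDim l (d + 2)))
      = (((l : ℝ) + 1) * (l + d - 1) * (d - 1)) * ((d - 1) * κ) := by
      rw [← h (l + 1)]
      calc _ = ((l : ℝ) + 1) * (l + d - 1) * znorm (d + 2) l
            * ((d : ℝ) * (d - 1) * harmDim l (d + 2)) := by ring
        _ = _ := by rw [hz, hh]; ring
    have h5 := mul_left_cancel₀ (by positivity) h4
    field_simp
    linear_combination h5

theorem harmDim_bounds {d : ℕ} (hd : 2 ≤ d) : ∃ c C : ℝ, 0 < c ∧ 0 < C ∧ ∀ l : ℕ,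
    c * (1 + (l : ℝ)) ^ (d - 2) ≤ harmDim l d ∧ harmDim l d ≤ C * (1 + (l : ℝ)) ^ (d - 2) := by
  obtain ⟨e, rfl⟩ := Nat.exists_eq_add_of_le hd
  clear hd
  simp only [Nat.add_sub_cancel_left]
  induction e using Nat.twoStepInduction with
  | zero =>
    refine ⟨1, 2, one_pos, two_pos, fun l => ?_⟩
    rw [Nat.add_zero, harmDim_two]
    split_ifs <;> norm_num
  | one =>
    refine ⟨1, 2, one_pos, two_pos, fun l => ?_⟩
    rw [harmDim_three]
    have : (0 : ℝ) ≤ l := by positivity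
    constructor <;> linarith
  | more e ih _ =>
    obtain ⟨c, C, hc, hC, h⟩ := ih
    have hd : 2 ≤ 2 + e := by omega
    have hd' : (2 : ℝ) ≤ ((2 + e : ℕ) : ℝ) := by exact_mod_cast hd
    rw [← add_assoc]
    set d := 2 + e
    have h1 : 0 < (d : ℝ) - 1 := by linarith
    have h0 : 0 < (d : ℝ) := by linarith
    refine ⟨c / (d * (d - 1)), C * 2 ^ e * d / (d * (d - 1)), by positivity, by positivity,
      fun l => ?_⟩
    have hl : (0 : ℝ) ≤ l := by positivity
    have hh : harmDim l (d + 2)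
        = ((l : ℝ) + 1) * (l + d - 1) * harmDim (l + 1) d / (d * (d - 1)) := by
      rw [← harmDim_step hd l]; field_simp
    obtain ⟨ha, hb⟩ := h (l + 1)
    push_cast at ha hb
    have g1 : (1 + (l : ℝ)) ^ e ≤ (1 + ((l : ℝ) + 1)) ^ e :=
      pow_le_pow_left₀ (by linarith) (by linarith) e
    have g2 : (1 + ((l : ℝ) + 1)) ^ e ≤ 2 ^ e * (1 + (l : ℝ)) ^ e := by
      rw [← mul_pow]; exact pow_le_pow_left₀ (by linarith) (by linarith) e
    have g3 : 1 + (l : ℝ) ≤ l + d - 1 := by linarith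
    have g4 : (l : ℝ) + d - 1 ≤ d * (1 + l) := by nlinarith
    have hp : 0 < (1 + (l : ℝ)) ^ e := by positivity
    have k1 : c * (1 + (l : ℝ)) ^ e ≤ harmDim (l + 1) d :=
      (mul_le_mul_of_nonneg_left g1 hc.le).trans ha
    have k2 : harmDim (l + 1) d ≤ C * (2 ^ e * (1 + (l : ℝ)) ^ e) :=
      hb.trans (mul_le_mul_of_nonneg_left g2 hC.le)
    have k0 : 0 ≤ harmDim (l + 1) d := le_trans (by positivity) k1
    rw [hh, div_mul_eq_mul_div, div_mul_eq_mul_div]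
    constructor
    · refine div_le_div_of_nonneg_right ?_ (by positivity)
      calc c * (1 + (l : ℝ)) ^ (e + 2) = (1 + (l : ℝ)) * (1 + l) * (c * (1 + (l : ℝ)) ^ e) := by
            ring
        _ ≤ ((l : ℝ) + 1) * (l + d - 1) * harmDim (l + 1) d := by
            rw [add_comm (1 : ℝ) l] at *
            have : 0 ≤ (l : ℝ) + d - 1 := by linarith
            gcongr
    · refine div_le_div_of_nonneg_right ?_ (by positivity)
      calc ((l : ℝ) + 1) * (l + d - 1) * harmDim (l + 1) d
          ≤ ((l : ℝ) + 1) * (d * (1 + l)) * (C * (2 ^ e * (1 + (l : ℝ)) ^ e)) := by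
            have : 0 ≤ (l : ℝ) + d - 1 := by linarith
            gcongr
        _ = _ := by ring

theorem eig_eq_zero {d l n : ℕ} (h : l < n) : eig d l n = 0 :=
  Finset.prod_eq_zero (Finset.mem_range.mpr h) (by simp)

theorem eig_bounds {d : ℕ} (hd : 2 ≤ d) (n : ℕ) : ∃ c C : ℝ, 0 < c ∧ 0 < C ∧ ∀ l : ℕ, n ≤ l →
    c * (1 + (l : ℝ)) ^ (2 * n) ≤ eig d l n ∧ eig d l n ≤ C * (1 + (l : ℝ)) ^ (2 * n) := by
  have hd' : (2 : ℝ) ≤ d := by exact_mod_cast hd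
  have hn : (0 : ℝ) ≤ n := by positivity
  -- For `i < n ≤ l` both factors `l-i` and `l+d-2+i` are at least `(1+l)/(1+n)`; from above they
  -- are at most `1+l` and `(d+n)(1+l)`.
  refine ⟨(1 / (1 + (n : ℝ)) ^ 2) ^ n, ((d : ℝ) + n) ^ n, by positivity, by positivity,
    fun l hl => ?_⟩
  have hl' : (n : ℝ) ≤ l := by exact_mod_cast hl
  have e1 : (1 / (1 + (n : ℝ)) ^ 2) ^ n * (1 + (l : ℝ)) ^ (2 * n)
      = ∏ i ∈ Finset.range n, ((1 + (l : ℝ)) / (1 + n) * ((1 + (l : ℝ)) / (1 + n))) := by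
    rw [Finset.prod_const, Finset.card_range, pow_mul, ← mul_pow]
    congr 1; field_simp
  have e2 : ((d : ℝ) + n) ^ n * (1 + (l : ℝ)) ^ (2 * n)
      = ∏ i ∈ Finset.range n, ((1 + (l : ℝ)) * ((d + n) * (1 + l))) := by
    rw [Finset.prod_const, Finset.card_range, pow_mul, ← mul_pow]
    congr 1; ring
  have key : ∀ i ∈ Finset.range n, (1 + (l : ℝ)) / (1 + n) ≤ l - i := by
    intro i hi
    have : (i : ℝ) + 1 ≤ n := by exact_mod_cast Finset.mem_range.mp hi
    have hi0 : (0 : ℝ) ≤ i := by positivity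
    rw [div_le_iff₀ (by positivity)]
    nlinarith
  have hq : 0 ≤ (1 + (l : ℝ)) / (1 + n) := by positivity
  rw [e1, e2, eig]
  constructor
  · refine Finset.prod_le_prod (fun i _ => by positivity) fun i hi => ?_
    have h1 := key i hi
    have hi0 : (0 : ℝ) ≤ i := by positivity
    exact mul_le_mul h1 (by linarith) hq (hq.trans h1)
  · refine Finset.prod_le_prod (fun i hi => ?_) fun i hi => ?_
    · have h1 := hq.trans (key i hi)
      have hi0 : (0 : ℝ) ≤ i := by positivity
      exact mul_nonneg h1 (by linarith)
    · have h1 := hq.trans (key i hi)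
      have hi0 : (0 : ℝ) ≤ i := by positivity
      have : (i : ℝ) + 1 ≤ n := by exact_mod_cast Finset.mem_range.mp hi
      have hl0 : (0 : ℝ) ≤ l := by positivity
      exact mul_le_mul (by linarith) (by nlinarith) (by linarith) (by positivity)

theorem eig_pos {d : ℕ} (hd : 2 ≤ d) {l n : ℕ} (h : n ≤ l) : 0 < eig d l n := by
  obtain ⟨c, C, hc, hC, hb⟩ := eig_bounds hd n
  exact lt_of_lt_of_le (by positivity) (hb l h).1

theorem eig_nonneg {d : ℕ} (hd : 2 ≤ d) (l n : ℕ) : 0 ≤ eig d l n := by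
  rcases lt_or_ge l n with h | h
  · rw [eig_eq_zero h]
  · exact (eig_pos hd h).le

theorem harmDim_pos {d : ℕ} (hd : 2 ≤ d) (l : ℕ) : 0 < harmDim l d := by
  obtain ⟨c, C, hc, hC, h⟩ := harmDim_bounds hd
  exact lt_of_lt_of_le (by positivity) (h l).1

theorem znorm_pos {d : ℕ} (hd : 2 ≤ d) (l : ℕ) : 0 < znorm d l := by
  obtain ⟨κ, hκ, h⟩ := exists_znorm_mul_harmDim hd
  exact pos_of_mul_pos_left (by rw [h l]; exact hκ) (harmDim_pos hd l).le

/-! ### Expansions in derivatives of zonal polynomials -/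

/-- The coefficient of `f` with respect to the `j`-th derivative of the zonal polynomial. -/
def zcoef (d j l : ℕ) (f : ℝ → ℝ) : ℝ := ∫ x, f x * (zder d l j).eval x ∂wm d j

theorem inner_toLp {d j : ℕ} {f g : ℝ → ℝ} (hf : MemLp f 2 (wm d j)) (hg : MemLp g 2 (wm d j)) :
    inner ℝ (hf.toLp f) (hg.toLp g) = ∫ x, f x * g x ∂wm d j := by
  rw [L2.inner_def]
  refine integral_congr_ae ?_
  filter_upwards [hf.coeFn_toLp, hg.coeFn_toLp] with x h1 h2
  rw [h1, h2]
  simp [mul_comm]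

theorem toLp_eta {d j : ℕ} (f : Lp ℝ 2 (wm d j)) : (Lp.memLp f).toLp f = f :=
  Lp.toLp_coeFn f (Lp.memLp f)

/-- The normalized derivatives of zonal polynomials. -/
def zbasisVec {d : ℕ} (hd : 2 ≤ d) (j l : ℕ) : Lp ℝ 2 (wm d j) :=
  -- The index is shifted by `j` because the `j`-th derivative of `Q_l` vanishes for `l < j`.
  (√(eig d (l + j) j * znorm d (l + j)))⁻¹ • (memLp_polynomial hd j (zder d (l + j) j)).toLp _

theorem inner_zbasisVec {d : ℕ} (hd : 2 ≤ d) (j l : ℕ) {f : ℝ → ℝ} (hf : MemLp f 2 (wm d j)) :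
    inner ℝ (hf.toLp f) (zbasisVec hd j l)
      = (√(eig d (l + j) j * znorm d (l + j)))⁻¹ * zcoef d j (l + j) f := by
  rw [zbasisVec, inner_smul_right, inner_toLp, zcoef]

theorem eig_mul_znorm_pos {d : ℕ} (hd : 2 ≤ d) {l j : ℕ} (h : j ≤ l) :
    0 < eig d l j * znorm d l :=
  mul_pos (eig_pos hd h) (znorm_pos hd _)

theorem orthonormal_zbasisVec {d : ℕ} (hd : 2 ≤ d) (j : ℕ) : Orthonormal ℝ (zbasisVec hd j) := by
  rw [orthonormal_iff_ite]
  intro l m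
  have hl := eig_mul_znorm_pos hd (Nat.le_add_left j l)
  rw [zbasisVec, inner_smul_left, inner_zbasisVec, zcoef]
  split_ifs with h
  · subst h
    rw [integral_zder_mul_self hd]
    have h1 := Real.mul_self_sqrt hl.le
    have h2 : √(eig d (l + j) j * znorm d (l + j)) ≠ 0 := (Real.sqrt_pos.mpr hl).ne'
    simp only [conj_trivial]
    field_simp
    rw [sq, h1]
  · rw [integral_zder_mul_zder_of_ne hd (by omega)]
    simp

/-- The measure is finite, so `L^2` functions are integrable and completeness in `L^1` applies. -/
theorem zbasisVec_orthogonal_eq_bot {d : ℕ} (hd : 2 ≤ d) (j : ℕ) :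
    (Submodule.span ℝ (Set.range (zbasisVec hd j)))ᗮ = ⊥ := by
  have := isFiniteMeasure_wm hd j
  rw [Submodule.eq_bot_iff]
  intro f hf
  have hz : ∀ l, j ≤ l → ∫ x, f x * (zder d l j).eval x ∂wm d j = 0 := by
    intro l hl
    obtain ⟨m, rfl⟩ := Nat.exists_eq_add_of_le' hl
    have h1 := (Submodule.mem_orthogonal' _ _).mp hf _
      (Submodule.subset_span (mem_range_self m))
    rw [← toLp_eta f, inner_zbasisVec] at h1
    exact (mul_eq_zero.mp h1).resolve_left
      (inv_ne_zero (Real.sqrt_pos.mpr (eig_mul_znorm_pos hd hl)).ne')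
  have h0 := ae_eq_zero_of_integral_zder hd ((Lp.memLp f).integrable one_le_two) hz
  rw [EventuallyEq, ← ae_wm d j] at h0
  exact Lp.eq_zero_iff_ae_eq_zero.mpr h0

/-- The Hilbert basis of normalized derivatives of zonal polynomials. -/
def zbasis {d : ℕ} (hd : 2 ≤ d) (j : ℕ) : HilbertBasis ℕ ℝ (Lp ℝ 2 (wm d j)) :=
  HilbertBasis.mkOfOrthogonalEqBot (orthonormal_zbasisVec hd j) (zbasisVec_orthogonal_eq_bot hd j)

theorem zbasis_apply {d : ℕ} (hd : 2 ≤ d) (j l : ℕ) : zbasis hd j l = zbasisVec hd j l := by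
  rw [zbasis, HilbertBasis.coe_mkOfOrthogonalEqBot]

/-- Parseval's identity. -/
theorem hasSum_zcoef_mul_zcoef {d : ℕ} (hd : 2 ≤ d) {j : ℕ} {f g : ℝ → ℝ}
    (hf : MemLp f 2 (wm d j)) (hg : MemLp g 2 (wm d j)) :
    HasSum (fun l => zcoef d j l f * zcoef d j l g / (eig d l j * znorm d l))
      (∫ x, f x * g x ∂wm d j) := by
  have h := (zbasis hd j).hasSum_inner_mul_inner (hf.toLp f) (hg.toLp g)
  rw [inner_toLp] at h
  -- The basis sees only the degrees `l ≥ j`. In the sum over all degrees the terms with `l < j` are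
  -- zero, since their denominator is `0` and division by zero gives `0`.
  have h2 := (Function.Injective.hasSum_iff (g := fun l => l + j) (add_left_injective j)
    (f := fun l => zcoef d j l f * zcoef d j l g / (eig d l j * znorm d l))
    (a := ∫ x, f x * g x ∂wm d j) ?_).mp
  · apply h2
    convert! h using 1
    funext l
    have hl := eig_mul_znorm_pos hd (Nat.le_add_left j l)
    rw [real_inner_comm (hg.toLp g), zbasis_apply, inner_zbasisVec, inner_zbasisVec]
    simp only [Function.comp]
    have h1 := Real.mul_self_sqrt hl.le
    have h2 : √(eig d (l + j) j * znorm d (l + j)) ≠ 0 := (Real.sqrt_pos.mpr hl).ne'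
    conv_lhs => rw [← h1]
    field_simp
  · intro l hl
    have : l < j := by
      by_contra hge
      exact hl ⟨l - j, Nat.sub_add_cancel (not_lt.mp hge)⟩
    rw [eig_eq_zero this, zero_mul, div_zero]

/-- The Riesz–Fischer theorem. -/
theorem exists_memLp_zcoef {d : ℕ} (hd : 2 ≤ d) (j : ℕ) {b : ℕ → ℝ}
    (hb : Summable fun l => b l ^ 2 / (eig d l j * znorm d l)) :
    ∃ f : ℝ → ℝ, MemLp f 2 (wm d j) ∧ ∀ l, j ≤ l → zcoef d j l f = b l := by
  set c : ℕ → ℝ := fun l => (√(eig d (l + j) j * znorm d (l + j)))⁻¹ * b (l + j) with hc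
  have hmem : Memℓp c 2 := by
    rw [memℓp_gen_iff (by norm_num)]
    refine ((summable_nat_add_iff j).mpr hb).congr fun l => ?_
    have hl := eig_mul_znorm_pos hd (Nat.le_add_left j l)
    simp only [hc, ENNReal.toReal_ofNat, Real.rpow_ofNat, Real.norm_eq_abs, sq_abs]
    rw [mul_pow, inv_pow, Real.sq_sqrt hl.le, inv_mul_eq_div]
  set F := (zbasis hd j).repr.symm ⟨c, hmem⟩ with hF
  refine ⟨F, Lp.memLp F, fun l hl => ?_⟩
  obtain ⟨m, rfl⟩ := Nat.exists_eq_add_of_le' hl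
  have h1 := (zbasis hd j).repr_apply_apply F m
  rw [hF, LinearIsometryEquiv.apply_symm_apply, ← hF, zbasis_apply, real_inner_comm,
    ← toLp_eta F, inner_zbasisVec] at h1
  exact (mul_left_cancel₀
    (inv_ne_zero (Real.sqrt_pos.mpr (eig_mul_znorm_pos hd hl)).ne') h1).symm

theorem coeff_eq_integral {d : ℕ} (hd : 2 ≤ d) (l : ℕ) (u : ℝ → ℝ) :
    coeff d l u = ∫ x, u x * (zpoly d l).eval x ∂wm d 0 := by
  rw [integral_wm, coeff]
  simp only [zonal_eq_eval hd]

theorem coeff_eq_zcoef {d : ℕ} (hd : 2 ≤ d) (l : ℕ) (u : ℝ → ℝ) :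
    coeff d l u = zcoef d 0 l u := coeff_eq_integral hd l u

theorem eig_zero (d l : ℕ) : eig d l 0 = 1 := by simp [eig]

/-- The coefficient of `v` is `eig` times that of `u`. After squaring and dividing by the squared
norm `eig · znorm`, one factor `eig` remains. -/
theorem HasWeakDeriv.hasSum_coeff_sq {d n : ℕ} (hd : 2 ≤ d) {u v : ℝ → ℝ}
    (h : HasWeakDeriv n u v) (hu : Integrable u (wm d 0)) (hv : MemLp v 2 (wm d n)) :
    HasSum (fun l => eig d l n * (coeff d l u ^ 2 / znorm d l)) (∫ x, v x ^ 2 ∂wm d n) := by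
  have := isFiniteMeasure_wm hd n
  have h1 := hasSum_zcoef_mul_zcoef hd hv hv
  simp only [← sq] at h1
  refine h1.congr_fun fun l => ?_
  rw [zcoef, h.integral_wm_zder l hu (hv.integrable one_le_two), ← coeff_eq_integral hd]
  rcases eq_or_ne (eig d l n) 0 with h0 | h0
  · simp [h0]
  · have := (znorm_pos hd l).ne'
    field_simp

/-- Riesz–Fischer gives a square integrable function with the same coefficients, and uniqueness in
`L^1` identifies it with `u`. -/
theorem memLp_of_summable_coeff {d : ℕ} (hd : 2 ≤ d) {u : ℝ → ℝ} (hu : Integrable u (wm d 0))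
    (hs : Summable fun l => coeff d l u ^ 2 / znorm d l) : MemLp u 2 (wm d 0) := by
  have := isFiniteMeasure_wm hd 0
  obtain ⟨f, hf, hc⟩ := exists_memLp_zcoef hd 0 (b := fun l => coeff d l u) (by
    simpa only [eig_zero, one_mul] using hs)
  have hfi := hf.integrable one_le_two
  have h0 := ae_eq_zero_of_integral_zder hd (hu.sub hfi) (fun l hl => by
    have h1 := hc l hl
    rw [coeff_eq_zcoef hd, zcoef, zcoef] at h1
    simp only [Pi.sub_apply, sub_mul]
    rw [integral_sub (integrable_mul_polynomial hu _) (integrable_mul_polynomial hfi _), h1,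
      sub_self])
  rw [EventuallyEq, ← ae_wm d 0] at h0
  refine hf.ae_eq ?_
  filter_upwards [h0] with x hx
  exact (sub_eq_zero.mp hx).symm

theorem locallyIntegrableOn_of_integrable_wm {d j : ℕ} {f : ℝ → ℝ} (hf : Integrable f (wm d j)) :
    LocallyIntegrableOn f (Ioo (-1 : ℝ) 1) := by
  have h1 := (integrable_wm_iff.mp hf).locallyIntegrableOn
  have h2 : ContinuousOn (fun x => (weight d j x)⁻¹) (Ioo (-1 : ℝ) 1) :=
    (continuousOn_weight d j).inv₀ fun x hx => (weight_pos d j hx).ne'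
  have h3 := h1.mul_continuousOn h2 isOpen_Ioo.isLocallyClosed
  intro x hx
  obtain ⟨t, ht, hi⟩ := h3 x hx
  refine ⟨t ∩ Ioo (-1) 1, inter_mem ht self_mem_nhdsWithin, ?_⟩
  have hi' := hi.mono_set (inter_subset_left (t := Ioo (-1 : ℝ) 1))
  refine hi'.congr ?_
  filter_upwards [ae_restrict_of_ae_restrict_of_subset inter_subset_right
    (ae_restrict_mem measurableSet_Ioo)] with y hy
  have := (weight_pos d j hy).ne'
  field_simp

/-- Dividing a test function by the weight. -/
theorem memLp_div_weight {d : ℕ} (hd : 2 ≤ d) (j : ℕ) {φ : ℝ → ℝ} (hφ : Continuous φ)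
    (hs : tsupport φ ⊆ Ioo (-1 : ℝ) 1) : MemLp (fun x => φ x / weight d j x) 2 (wm d j) := by
  have := isFiniteMeasure_wm hd j
  have hc : ContinuousOn (fun x => φ x / weight d j x) (tsupport φ) :=
    hφ.continuousOn.div ((continuousOn_weight d j).mono hs) fun x hx => (weight_pos d j (hs hx)).ne'
  obtain ⟨K, hK⟩ := (hasCompactSupport_of_tsupport_subset_Ioo hs).isCompact
    |>.exists_bound_of_continuousOn hc
  refine MemLp.of_bound (hφ.measurable.div (measurable_weight d j)).aestronglyMeasurable
    (max K 0) (Eventually.of_forall fun x => ?_)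
  by_cases hx : x ∈ tsupport φ
  · exact (hK x hx).trans (le_max_left _ _)
  · rw [image_eq_zero_of_notMem_tsupport hx]; simp

theorem integral_mul_div_weight (d j : ℕ) (f φ : ℝ → ℝ) :
    ∫ x, f x * (φ x / weight d j x) ∂wm d j = ∫ x in Ioo (-1 : ℝ) 1, f x * φ x := by
  rw [integral_wm]
  refine setIntegral_congr_fun measurableSet_Ioo fun x hx => ?_
  have := (weight_pos d j hx).ne'
  field_simp

theorem tsupport_iteratedDeriv_subset (n : ℕ) (φ : ℝ → ℝ) :
    tsupport (iteratedDeriv n φ) ⊆ tsupport φ := by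
  induction n with
  | zero => rw [iteratedDeriv_zero]
  | succ n ih => rw [iteratedDeriv_succ]; exact tsupport_deriv_subset.trans ih

/-- The candidate derivative has coefficients `eig · u_l`. To test it, the test function is divided
by the weight so that both sides of the weak identity become Parseval series; these agree term by
term through integration by parts against a polynomial. -/
theorem exists_hasWeakDeriv_of_summable {d : ℕ} (hd : 2 ≤ d) (n : ℕ) {u : ℝ → ℝ}
    (hu : Integrable u (wm d 0)) (h0 : Summable fun l => coeff d l u ^ 2 / znorm d l)
    (hn : Summable fun l => eig d l n * (coeff d l u ^ 2 / znorm d l)) :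
    ∃ v, HasWeakDeriv n u v ∧ MemLp v 2 (wm d n) := by
  have := isFiniteMeasure_wm hd n
  have hu2 := memLp_of_summable_coeff hd hu h0
  obtain ⟨v, hv, hc⟩ := exists_memLp_zcoef hd n (b := fun l => eig d l n * coeff d l u) (by
    refine hn.congr fun l => ?_
    rcases eq_or_ne (eig d l n) 0 with h0 | h0
    · simp [h0]
    · have := (znorm_pos hd l).ne'
      field_simp)
  refine ⟨v, ⟨locallyIntegrableOn_of_integrable_wm hu,
    locallyIntegrableOn_of_integrable_wm (hv.integrable one_le_two), fun φ hφ _ hs => ?_⟩, hv⟩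
  have hsn := (tsupport_iteratedDeriv_subset n φ).trans hs
  have hg := memLp_div_weight hd 0
    (hφ.continuous_iteratedDeriv n (by exact_mod_cast le_top)) hsn
  have hψ := memLp_div_weight hd n hφ.continuous hs
  have s1 := hasSum_zcoef_mul_zcoef hd hu2 hg
  have s2 := (hasSum_zcoef_mul_zcoef hd hv hψ).mul_left ((-1 : ℝ) ^ n)
  rw [integral_mul_div_weight] at s1 s2
  refine s1.unique (s2.congr_fun fun l => ?_)
  have e1 : zcoef d n l (fun x => φ x / weight d n x)
      = ∫ x in Ioo (-1 : ℝ) 1, (zder d l n).eval x * φ x := by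
    rw [zcoef, ← integral_mul_div_weight d n]
    simp only [mul_comm]
  have e2 : zcoef d 0 l (fun x => iteratedDeriv n φ x / weight d 0 x)
      = (-1) ^ n * ∫ x in Ioo (-1 : ℝ) 1, (zder d l n).eval x * φ x := by
    rw [zder, ← integral_polynomial_mul_iteratedDeriv n (zpoly d l) φ hφ hs, zcoef,
      ← integral_mul_div_weight d 0]
    simp only [mul_comm]
    rfl
  rw [e1, e2, eig_zero, one_mul, ← coeff_eq_zcoef hd]
  rcases lt_or_ge l n with hl | hl
  · have : zder d l n = 0 := by
      rw [zder]; exact iterate_derivative_eq_zero (by rw [zpoly_natDegree hd]; exact hl)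
    simp [this]
  · rw [hc l hl]
    have h1 := (eig_pos hd hl).ne'
    have h2 := (znorm_pos hd l).ne'
    field_simp

/-! ### Integer order norms in terms of coefficients -/

/-- The squared weighted sequence norm of the coefficients. -/
def specSq (d : ℕ) (s : ℝ) (u : ℝ → ℝ) : ℝ≥0∞ :=
  ∑' l : ℕ, ENNReal.ofReal (coeff d l u ^ 2 * (1 + (l : ℝ)) ^ ((d : ℝ) - 2 + 2 * s))

theorem inv_znorm_bounds {d : ℕ} (hd : 2 ≤ d) : ∃ c C : ℝ, 0 < c ∧ 0 < C ∧ ∀ l : ℕ,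
    c * (1 + (l : ℝ)) ^ ((d : ℝ) - 2) ≤ (znorm d l)⁻¹ ∧
      (znorm d l)⁻¹ ≤ C * (1 + (l : ℝ)) ^ ((d : ℝ) - 2) := by
  obtain ⟨κ, hκ, h⟩ := exists_znorm_mul_harmDim hd
  obtain ⟨c, C, hc, hC, hb⟩ := harmDim_bounds hd
  refine ⟨c / κ, C / κ, by positivity, by positivity, fun l => ?_⟩
  have e : (znorm d l)⁻¹ = harmDim l d / κ := by
    have h1 := (znorm_pos hd l).ne'
    have h2 := (harmDim_pos hd l).ne'
    rw [← h l]; field_simp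
  have e2 : (1 + (l : ℝ)) ^ ((d : ℝ) - 2) = (1 + (l : ℝ)) ^ (d - 2) := by
    rw [← Real.rpow_natCast, Nat.cast_sub hd]; norm_num
  rw [e, e2, div_mul_eq_mul_div, div_mul_eq_mul_div]
  exact ⟨div_le_div_of_nonneg_right (hb l).1 hκ.le, div_le_div_of_nonneg_right (hb l).2 hκ.le⟩

theorem rpow_spec (l : ℕ) (a : ℝ) (n : ℕ) :
    (1 + (l : ℝ)) ^ (a + 2 * (n : ℝ)) = (1 + (l : ℝ)) ^ a * (1 + (l : ℝ)) ^ (2 * n) := by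
  rw [Real.rpow_add (by positivity), ← Real.rpow_natCast]; push_cast; rfl

theorem lintegral_eq_of_memLp {d j : ℕ} {v : ℝ → ℝ} (hv : MemLp v 2 (wm d j)) :
    ∫⁻ x in Ioo (-1 : ℝ) 1, ENNReal.ofReal (v x ^ 2 * weight d j x)
      = ENNReal.ofReal (∫ x, v x ^ 2 ∂wm d j) := by
  have h := integrable_wm_iff.mp ((memLp_two_iff_integrable_sq hv.1).mp hv)
  rw [integral_wm, ofReal_integral_eq_lintegral_ofReal h]
  filter_upwards [ae_restrict_mem measurableSet_Ioo] with x hx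
  exact mul_nonneg (sq_nonneg _) (weight_pos d j hx).le

theorem memLp_of_lintegral_ne_top {d j : ℕ} {v : ℝ → ℝ}
    (hv : LocallyIntegrableOn v (Ioo (-1 : ℝ) 1))
    (h : ∫⁻ x in Ioo (-1 : ℝ) 1, ENNReal.ofReal (v x ^ 2 * weight d j x) ≠ ⊤) :
    MemLp v 2 (wm d j) := by
  have hm : AEStronglyMeasurable v (volume.restrict (Ioo (-1 : ℝ) 1)) := hv.aestronglyMeasurable
  rw [memLp_two_iff_integrable_sq (aestronglyMeasurable_wm_iff.mpr hm), integrable_wm_iff]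
  refine (lintegral_ofReal_ne_top_iff_integrable
    ((hm.pow 2).mul (measurable_weight d j).aestronglyMeasurable) ?_).mp h
  filter_upwards [ae_restrict_mem measurableSet_Ioo] with x hx
  exact mul_nonneg (sq_nonneg _) (weight_pos d j hx).le

/-- The contribution of degree `l` to the squared seminorm of order `j`. -/
def specTerm (d j l : ℕ) (u : ℝ → ℝ) : ℝ := eig d l j * (coeff d l u ^ 2 / znorm d l)

theorem specTerm_nonneg {d : ℕ} (hd : 2 ≤ d) (j l : ℕ) (u : ℝ → ℝ) : 0 ≤ specTerm d j l u :=
  mul_nonneg (eig_nonneg hd l j) (div_nonneg (sq_nonneg _) (znorm_pos hd l).le)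

theorem HasWeakDeriv.lintegral_eq_tsum {d j : ℕ} (hd : 2 ≤ d) {u v : ℝ → ℝ}
    (h : HasWeakDeriv j u v) (hu : Integrable u (wm d 0)) (hv : MemLp v 2 (wm d j)) :
    ∫⁻ x in Ioo (-1 : ℝ) 1, ENNReal.ofReal (v x ^ 2 * weight d j x)
      = ∑' l, ENNReal.ofReal (specTerm d j l u) := by
  have hs : HasSum (fun l => specTerm d j l u) _ := h.hasSum_coeff_sq hd hu hv
  rw [lintegral_eq_of_memLp hv, ← hs.tsum_eq,
    ENNReal.ofReal_tsum_of_nonneg (fun l => specTerm_nonneg hd j l u) hs.summable]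

/-- Every admissible derivative either has infinite weighted integral or satisfies Parseval with
equality, so no finiteness has to be assumed. -/
theorem tsum_specTerm_le_seminormSq {d : ℕ} (hd : 2 ≤ d) (j : ℕ) {u : ℝ → ℝ}
    (hu : Integrable u (wm d 0)) :
    ∑' l, ENNReal.ofReal (specTerm d j l u) ≤ seminormSq d j u := by
  refine le_iInf₂ fun v hv => ?_
  by_cases h : ∫⁻ x in Ioo (-1 : ℝ) 1, ENNReal.ofReal (v x ^ 2 * weight d j x) = ⊤
  · rw [h]; exact le_top
  · exact (hv.lintegral_eq_tsum hd hu (memLp_of_lintegral_ne_top hv.2.1 h)).ge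

theorem seminormSq_le_tsum_specTerm {d : ℕ} (hd : 2 ≤ d) (j : ℕ) {u : ℝ → ℝ}
    (hu : Integrable u (wm d 0)) (h0 : Summable fun l => specTerm d 0 l u)
    (hj : Summable fun l => specTerm d j l u) :
    seminormSq d j u ≤ ∑' l, ENNReal.ofReal (specTerm d j l u) := by
  obtain ⟨v, hv, hv2⟩ := exists_hasWeakDeriv_of_summable hd j hu
    (by simpa only [specTerm, eig_zero, one_mul] using h0) hj
  rw [← hv.lintegral_eq_tsum hd hu hv2]
  exact iInf₂_le v hv

theorem summable_of_tsum_ofReal_ne_top {f : ℕ → ℝ} (hf : ∀ l, 0 ≤ f l)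
    (h : ∑' l, ENNReal.ofReal (f l) ≠ ⊤) : Summable f := by
  have := ENNReal.summable_toReal h
  exact this.congr fun l => ENNReal.toReal_ofReal (hf l)

theorem specTerm_le {d : ℕ} (hd : 2 ≤ d) (j : ℕ) : ∃ K : ℝ, 0 < K ∧ ∀ (u : ℝ → ℝ) (l n : ℕ),
    j ≤ n → specTerm d j l u
      ≤ K * (coeff d l u ^ 2 * (1 + (l : ℝ)) ^ ((d : ℝ) - 2 + 2 * (n : ℝ))) := by
  obtain ⟨c, C, hc, hC, h⟩ := inv_znorm_bounds hd
  obtain ⟨c', C', hc', hC', h'⟩ := eig_bounds hd j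
  refine ⟨C' * C, by positivity, fun u l n hn => ?_⟩
  have he : eig d l j ≤ C' * (1 + (l : ℝ)) ^ (2 * n) := by
    rcases lt_or_ge l j with hl | hl
    · rw [eig_eq_zero hl]; positivity
    · refine (h' l hl).2.trans (mul_le_mul_of_nonneg_left ?_ hC'.le)
      exact pow_le_pow_right₀ (by linarith [(Nat.cast_nonneg l : (0 : ℝ) ≤ l)]) (by omega)
  rw [rpow_spec, specTerm, div_eq_mul_inv]
  have hz := inv_nonneg.mpr (znorm_pos hd l).le
  calc eig d l j * (coeff d l u ^ 2 * (znorm d l)⁻¹)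
      ≤ C' * (1 + (l : ℝ)) ^ (2 * n)
        * (coeff d l u ^ 2 * (C * (1 + (l : ℝ)) ^ ((d : ℝ) - 2))) := by
        gcongr
        exact (h l).2
    _ = _ := by ring

theorem le_specTerm {d : ℕ} (hd : 2 ≤ d) (n : ℕ) : ∃ K : ℝ, 0 < K ∧ ∀ (u : ℝ → ℝ) (l : ℕ),
    coeff d l u ^ 2 * (1 + (l : ℝ)) ^ ((d : ℝ) - 2 + 2 * (n : ℝ))
      ≤ K * (specTerm d 0 l u + specTerm d n l u) := by
  obtain ⟨c, C, hc, hC, h⟩ := inv_znorm_bounds hd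
  obtain ⟨c', C', hc', hC', h'⟩ := eig_bounds hd n
  -- Since `eig d l n` vanishes for `l < n`, the finitely many low degrees are controlled by the
  -- order-zero term, at the price `(1+n)^(2n)`; the lower bound on `eig` handles `l ≥ n`.
  refine ⟨c⁻¹ * ((1 + (n : ℝ)) ^ (2 * n) + c'⁻¹), by positivity, fun u l => ?_⟩
  have he : (1 + (l : ℝ)) ^ (2 * n)
      ≤ ((1 + (n : ℝ)) ^ (2 * n) + c'⁻¹) * (1 + eig d l n) := by
    have h0 := eig_nonneg hd l n
    have hn : (0 : ℝ) ≤ (1 + (n : ℝ)) ^ (2 * n) := by positivity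
    have hci : 0 < c'⁻¹ := inv_pos.mpr hc'
    rcases lt_or_ge l n with hl | hl
    · have hl' : (l : ℝ) ≤ n := by exact_mod_cast hl.le
      have : (1 + (l : ℝ)) ^ (2 * n) ≤ (1 + (n : ℝ)) ^ (2 * n) :=
        pow_le_pow_left₀ (by positivity) (by linarith) _
      nlinarith
    · have h1 := (h' l hl).1
      have : (1 + (l : ℝ)) ^ (2 * n) ≤ c'⁻¹ * eig d l n := by
        rw [← div_eq_inv_mul, le_div_iff₀ hc', mul_comm]; exact h1
      nlinarith
  have hz : (1 + (l : ℝ)) ^ ((d : ℝ) - 2) ≤ c⁻¹ * (znorm d l)⁻¹ := by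
    rw [← div_eq_inv_mul, le_div_iff₀ hc, mul_comm]; exact (h l).1
  have hz0 := inv_nonneg.mpr (znorm_pos hd l).le
  have hci : 0 < c⁻¹ := inv_pos.mpr hc
  rw [rpow_spec, specTerm, specTerm, eig_zero, div_eq_mul_inv]
  calc coeff d l u ^ 2 * ((1 + (l : ℝ)) ^ ((d : ℝ) - 2) * (1 + (l : ℝ)) ^ (2 * n))
      ≤ coeff d l u ^ 2 * ((c⁻¹ * (znorm d l)⁻¹)
        * (((1 + (n : ℝ)) ^ (2 * n) + c'⁻¹) * (1 + eig d l n))) := by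
        gcongr
    _ = _ := by ring

theorem specSq_le_intNormSq {d : ℕ} (hd : 2 ≤ d) (n : ℕ) : ∃ K : ℝ, 0 < K ∧ ∀ u : ℝ → ℝ,
    Integrable u (wm d 0) → specSq d n u ≤ ENNReal.ofReal K * intNormSq d n u := by
  obtain ⟨K, hK, h⟩ := le_specTerm hd n
  refine ⟨K * 2, by positivity, fun u hu => ?_⟩
  have hs : ∀ j ≤ n, ∑' l, ENNReal.ofReal (specTerm d j l u) ≤ intNormSq d n u := fun j hj =>
    (tsum_specTerm_le_seminormSq hd j hu).trans
      (Finset.single_le_sum (f := fun j => seminormSq d j u) (fun _ _ => zero_le)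
        (Finset.mem_range.mpr (by omega)))
  calc specSq d n u
      ≤ ∑' l, ENNReal.ofReal K *
          (ENNReal.ofReal (specTerm d 0 l u) + ENNReal.ofReal (specTerm d n l u)) := by
        refine ENNReal.tsum_le_tsum fun l => ?_
        rw [← ENNReal.ofReal_add (specTerm_nonneg hd 0 l u) (specTerm_nonneg hd n l u),
          ← ENNReal.ofReal_mul hK.le]
        exact ENNReal.ofReal_le_ofReal (h u l)
    _ = ENNReal.ofReal K * (∑' l, ENNReal.ofReal (specTerm d 0 l u)
          + ∑' l, ENNReal.ofReal (specTerm d n l u)) := by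
        rw [ENNReal.tsum_mul_left, ENNReal.tsum_add]
    _ ≤ ENNReal.ofReal K * (intNormSq d n u + intNormSq d n u) := by
        gcongr
        · exact hs 0 (Nat.zero_le n)
        · exact hs n le_rfl
    _ = _ := by
        rw [ENNReal.ofReal_mul hK.le, ← two_mul, ENNReal.ofReal_ofNat, mul_assoc]

theorem intNormSq_le_specSq {d : ℕ} (hd : 2 ≤ d) (n : ℕ) : ∃ K : ℝ, 0 < K ∧ ∀ u : ℝ → ℝ,
    Integrable u (wm d 0) → intNormSq d n u ≤ ENNReal.ofReal K * specSq d n u := by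
  choose K hK h using fun j => specTerm_le hd j
  refine ⟨∑ j ∈ Finset.range (n + 1), K j, Finset.sum_pos (fun j _ => hK j) (by simp),
    fun u hu => ?_⟩
  have hKs : 0 < ∑ j ∈ Finset.range (n + 1), K j := Finset.sum_pos (fun j _ => hK j) (by simp)
  -- Summability of the coefficients is needed to construct the derivatives. In the infinite case
  -- the bound is trivial because the constant is positive.
  by_cases htop : specSq d n u = ⊤
  · rw [htop, ENNReal.mul_top (by simpa using hKs)]; exact le_top
  have hb : ∀ j ≤ n, ∑' l, ENNReal.ofReal (specTerm d j l u)
      ≤ ENNReal.ofReal (K j) * specSq d n u := by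
    intro j hj
    rw [specSq, ← ENNReal.tsum_mul_left]
    refine ENNReal.tsum_le_tsum fun l => ?_
    rw [← ENNReal.ofReal_mul (hK j).le]
    exact ENNReal.ofReal_le_ofReal (h j u l n hj)
  have hsum : ∀ j ≤ n, Summable fun l => specTerm d j l u := fun j hj =>
    summable_of_tsum_ofReal_ne_top (fun l => specTerm_nonneg hd j l u)
      (ne_top_of_le_ne_top (ENNReal.mul_ne_top ENNReal.ofReal_ne_top htop) (hb j hj))
  rw [intNormSq, ENNReal.ofReal_sum_of_nonneg (fun j _ => (hK j).le), Finset.sum_mul]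
  refine Finset.sum_le_sum fun j hj => ?_
  have hj' : j ≤ n := Nat.lt_succ_iff.mp (Finset.mem_range.mp hj)
  exact (seminormSq_le_tsum_specTerm hd j hu (hsum 0 (Nat.zero_le n)) (hsum j hj')).trans
    (hb j hj')

/-! ### Partial sums -/

/-- The partial sum of the expansion of `u` over a finite set of degrees. -/
def partialPoly (d : ℕ) (s : Finset ℕ) (u : ℝ → ℝ) : ℝ[X] :=
  ∑ l ∈ s, C (coeff d l u / znorm d l) * zpoly d l

theorem coeff_partialPoly {d : ℕ} (hd : 2 ≤ d) (s : Finset ℕ) (u : ℝ → ℝ) (l : ℕ) :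
    coeff d l (fun x => (partialPoly d s u).eval x) = if l ∈ s then coeff d l u else 0 := by
  rw [coeff_eq_integral hd]
  have e : ∀ x, (partialPoly d s u).eval x * (zpoly d l).eval x
      = ∑ m ∈ s, coeff d m u / znorm d m * ((zpoly d m).eval x * (zpoly d l).eval x) := by
    intro x
    rw [partialPoly, eval_finsetSum, Finset.sum_mul]
    refine Finset.sum_congr rfl fun m _ => ?_
    rw [eval_mul, eval_C]; ring
  simp only [e]
  rw [integral_finsetSum _ fun m _ =>
    (integrable_mul_polynomial (integrable_polynomial hd 0 _) _).const_mul _]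
  simp only [integral_const_mul]
  split_ifs with h
  · rw [Finset.sum_eq_single_of_mem l h fun m _ hm => by
      rw [integral_zpoly_mul_zpoly_of_ne hd hm, mul_zero]]
    exact div_mul_cancel₀ _ (znorm_pos hd l).ne'
  · refine Finset.sum_eq_zero fun m hm => ?_
    rw [integral_zpoly_mul_zpoly_of_ne hd (by rintro rfl; exact h hm), mul_zero]

theorem coeff_add {d : ℕ} (hd : 2 ≤ d) (l : ℕ) {v w : ℝ → ℝ} (hv : Integrable v (wm d 0))
    (hw : Integrable w (wm d 0)) : coeff d l (v + w) = coeff d l v + coeff d l w := by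
  simp only [coeff_eq_integral hd, Pi.add_apply, add_mul]
  exact integral_add (integrable_mul_polynomial hv _) (integrable_mul_polynomial hw _)

theorem coeff_sub {d : ℕ} (hd : 2 ≤ d) (l : ℕ) {v w : ℝ → ℝ} (hv : Integrable v (wm d 0))
    (hw : Integrable w (wm d 0)) : coeff d l (v - w) = coeff d l v - coeff d l w := by
  simp only [coeff_eq_integral hd, Pi.sub_apply, sub_mul]
  exact integral_sub (integrable_mul_polynomial hv _) (integrable_mul_polynomial hw _)

theorem coeff_sub_partialPoly {d : ℕ} (hd : 2 ≤ d) (s : Finset ℕ) {u : ℝ → ℝ}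
    (hu : Integrable u (wm d 0)) (l : ℕ) :
    coeff d l (u - fun x => (partialPoly d s u).eval x) = if l ∈ s then 0 else coeff d l u := by
  rw [coeff_sub hd l hu (integrable_polynomial hd 0 _), coeff_partialPoly hd]
  split_ifs <;> simp

theorem integrable_sub_polynomial {d : ℕ} (hd : 2 ≤ d) {u : ℝ → ℝ} (hu : Integrable u (wm d 0))
    (q : ℝ[X]) : Integrable (u - fun x => q.eval x) (wm d 0) :=
  hu.sub (integrable_polynomial hd 0 q)

theorem polynomial_mem_HSpace (n : ℕ) (q : ℝ[X]) : (fun x => q.eval x) ∈ HSpace n := by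
  intro j _
  refine ⟨_, hasWeakDeriv_polynomial j q, ?_⟩
  obtain ⟨K, hK⟩ := polynomial_bounded (derivative^[j] q)
  refine MemLp.of_bound (derivative^[j] q).continuous.aestronglyMeasurable K ?_
  filter_upwards [ae_restrict_mem measurableSet_Ioo] with x hx using hK x (Ioo_subset_Icc_self hx)

theorem intNorm_sq (d n : ℕ) (u : ℝ → ℝ) : intNorm d n u ^ 2 = intNormSq d n u := by
  rw [intNorm, ← ENNReal.rpow_natCast, ← ENNReal.rpow_mul]; norm_num

theorem intNorm_lt_iff {d n : ℕ} {u : ℝ → ℝ} {ε : ℝ≥0∞} :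
    intNorm d n u < ε ↔ intNormSq d n u < ε ^ 2 := by
  rw [← intNorm_sq]
  exact (ENNReal.pow_lt_pow_left_iff two_ne_zero).symm

/-- The closure condition comes for free: the partial sums are polynomials, hence in `H^n`, and the
norm of the remainder is bounded by the tail of a convergent series. -/
theorem mem_IntV_iff {d : ℕ} (hd : 2 ≤ d) (n : ℕ) {u : ℝ → ℝ} (hu : Integrable u (wm d 0)) :
    u ∈ IntV d n ↔ specSq d n u < ⊤ := by
  obtain ⟨K₁, hK₁, h₁⟩ := specSq_le_intNormSq hd n
  obtain ⟨K₂, hK₂, h₂⟩ := intNormSq_le_specSq hd n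
  constructor
  · rintro ⟨h, -⟩
    rw [intNorm_lt_iff, ENNReal.top_pow two_ne_zero] at h
    exact (h₁ u hu).trans_lt (ENNReal.mul_lt_top ENNReal.ofReal_lt_top h)
  · intro h
    refine ⟨?_, fun ε hε => ?_⟩
    · rw [intNorm_lt_iff, ENNReal.top_pow two_ne_zero]
      exact (h₂ u hu).trans_lt (ENNReal.mul_lt_top ENNReal.ofReal_lt_top h)
    · have ht := ENNReal.Tendsto.const_mul (a := ENNReal.ofReal K₂)
        (ENNReal.tendsto_tsum_compl_atTop_zero h.ne) (Or.inr ENNReal.ofReal_ne_top)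
      rw [mul_zero] at ht
      obtain ⟨s, hs⟩ := (ht.eventually (Iio_mem_nhds (ENNReal.pow_pos hε 2))).exists
      refine ⟨_, polynomial_mem_HSpace n (partialPoly d s u), ?_⟩
      rw [intNorm_lt_iff]
      refine (h₂ _ (integrable_sub_polynomial hd hu _)).trans_lt ?_
      convert! hs using 2
      rw [specSq]
      simp only [coeff_sub_partialPoly hd s hu]
      have := tsum_subtype {l : ℕ | l ∉ s}
        (fun l : ℕ => ENNReal.ofReal (coeff d l u ^ 2 * (1 + (l : ℝ)) ^ ((d : ℝ) - 2 + 2 * (n : ℝ))))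
      refine Eq.trans ?_ this.symm
      congr 1
      funext l
      by_cases hl : l ∈ s
      · rw [if_pos hl, Set.indicator_of_notMem (by simpa using hl)]; simp
      · rw [if_neg hl, Set.indicator_of_mem (by simpa using hl)]

/-- The order-zero seminorm is an infimum over weak derivatives of order `0`; this identifies those
with `u` itself. -/
theorem ae_eq_of_hasWeakDeriv_zero {u v : ℝ → ℝ} (h : HasWeakDeriv 0 u v) :
    u =ᵐ[volume.restrict (Ioo (-1 : ℝ) 1)] v := by
  have := IsOpen.ae_eq_zero_of_integral_contDiff_smul_eq_zero (U := Ioo (-1 : ℝ) 1) (f := u - v)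
    (μ := volume) isOpen_Ioo (h.1.sub h.2.1) ?_
  · rw [EventuallyEq, ae_restrict_iff' measurableSet_Ioo]
    filter_upwards [this] with x hx hm
    exact sub_eq_zero.mp (hx hm)
  · intro φ hφ hc hs
    have h1 := h.2.2 φ hφ hc hs
    simp only [iteratedDeriv_zero, pow_zero, one_mul] at h1
    have hi : ∀ f : ℝ → ℝ, LocallyIntegrableOn f (Ioo (-1 : ℝ) 1) →
        IntegrableOn (fun x => f x * φ x) (Ioo (-1 : ℝ) 1) := by
      intro f hf
      have hk : IntegrableOn (fun x => f x * φ x) (tsupport φ) :=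
        (hf.integrableOn_compact_subset hs hc).mul_continuousOn hφ.continuous.continuousOn hc
      exact (integrableOn_iff_integrable_of_support_subset (fun x hx => subset_tsupport φ
        (right_ne_zero_of_mul hx))).mp hk |>.integrableOn
    have e : ∫ x, φ x • (u - v) x = ∫ x in Ioo (-1 : ℝ) 1, (u x * φ x - v x * φ x) := by
      rw [setIntegral_eq_integral_of_forall_compl_eq_zero]
      · congr 1; funext x; simp only [Pi.sub_apply, smul_eq_mul]; ring
      · intro x hx
        rw [image_eq_zero_of_notMem_tsupport (fun h => hx (hs h))]; simp
    rw [e, integral_sub (hi u h.1) (hi v h.2.1), h1, sub_self]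

theorem integrable_of_intNorm_lt_top {d : ℕ} (hd : 2 ≤ d) {n : ℕ} {u : ℝ → ℝ}
    (h : intNorm d n u < ⊤) : Integrable u (wm d 0) := by
  have := isFiniteMeasure_wm hd 0
  rw [intNorm_lt_iff, ENNReal.top_pow two_ne_zero] at h
  have h0 : seminormSq d 0 u < ⊤ := (Finset.single_le_sum (f := fun j => seminormSq d j u)
    (fun _ _ => zero_le) (Finset.mem_range.mpr (Nat.succ_pos n))).trans_lt h
  obtain ⟨v, hv⟩ := iInf_lt_iff.mp h0
  obtain ⟨hw, hlt⟩ := iInf_lt_iff.mp hv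
  have h2 := memLp_of_lintegral_ne_top hw.2.1 hlt.ne
  have hae := ae_eq_of_hasWeakDeriv_zero hw
  rw [EventuallyEq, ← ae_wm d 0] at hae
  exact (h2.integrable one_le_two).congr (EventuallyEq.symm hae)

/-! ### Real interpolation -/

/-- The `K`-functional of the weighted sequence spaces, squared. -/
def specK (d n : ℕ) (t : ℝ) (u : ℝ → ℝ) : ℝ≥0∞ :=
  ∑' l : ℕ, ENNReal.ofReal (coeff d l u ^ 2 * (1 + (l : ℝ)) ^ ((d : ℝ) - 2 + 2 * (n : ℝ))
    * min 1 ((t * (1 + l)) ^ 2))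

theorem add_sq_le_two_mul (a b : ℝ≥0∞) : (a + b) ^ 2 ≤ 2 * (a ^ 2 + b ^ 2) := by
  have h := ENNReal.rpow_add_le_mul_rpow_add_rpow a b (p := 2) (by norm_num)
  norm_num at h
  exact h

/-- For any splitting `u = v + w`, the minimum is bounded by `1` on the coefficients of `v` and by
`t²(1+l)²` on those of `w`. -/
theorem specK_le_kFunctional_sq {d : ℕ} (hd : 2 ≤ d) (n : ℕ) : ∃ K : ℝ, 0 < K ∧
    ∀ u : ℝ → ℝ, ∀ t > 0,
      specK d n t u ≤ ENNReal.ofReal K * kFunctional d n t u ^ 2 := by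
  obtain ⟨K₁, hK₁, h₁⟩ := specSq_le_intNormSq hd n
  obtain ⟨K₂, hK₂, h₂⟩ := specSq_le_intNormSq hd (n + 1)
  set K := 2 * (K₁ + K₂) with hK
  have hKp : 0 < K := by positivity
  refine ⟨K, hKp, fun u t ht => ?_⟩
  have hK0 : ENNReal.ofReal K ≠ 0 := by simpa using hKp
  have key : ∀ v w : ℝ → ℝ, v ∈ IntV d n → w ∈ IntV d (n + 1) →
      u =ᵐ[volume.restrict (Ioo (-1 : ℝ) 1)] v + w →
      specK d n t u ≤ ENNReal.ofReal K
        * (intNorm d n v + ENNReal.ofReal t * intNorm d (n + 1) w) ^ 2 := by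
    intro v w hv hw huv
    have hvi := integrable_of_intNorm_lt_top hd hv.1
    have hwi := integrable_of_intNorm_lt_top hd hw.1
    have hco : ∀ l, coeff d l u = coeff d l v + coeff d l w := by
      intro l
      rw [← coeff_add hd l hvi hwi]
      refine integral_congr_ae ?_
      filter_upwards [huv] with x hx
      rw [hx]
    have hterm : ∀ l : ℕ, coeff d l u ^ 2 * (1 + (l : ℝ)) ^ ((d : ℝ) - 2 + 2 * (n : ℝ))
          * min 1 ((t * (1 + l)) ^ 2)
        ≤ 2 * (coeff d l v ^ 2 * (1 + (l : ℝ)) ^ ((d : ℝ) - 2 + 2 * (n : ℝ)))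
          + 2 * t ^ 2 * (coeff d l w ^ 2
            * (1 + (l : ℝ)) ^ ((d : ℝ) - 2 + 2 * ((n + 1 : ℕ) : ℝ))) := by
      intro l
      have e : (1 + (l : ℝ)) ^ ((d : ℝ) - 2 + 2 * ((n + 1 : ℕ) : ℝ))
          = (1 + (l : ℝ)) ^ ((d : ℝ) - 2 + 2 * (n : ℝ)) * (1 + l) ^ 2 := by
        rw [rpow_spec, rpow_spec]; ring
      rw [e, hco]
      have hp : 0 < (1 + (l : ℝ)) ^ ((d : ℝ) - 2 + 2 * (n : ℝ)) := by positivity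
      set P := (1 + (l : ℝ)) ^ ((d : ℝ) - 2 + 2 * (n : ℝ))
      set a := coeff d l v
      set b := coeff d l w
      have m1 : min 1 ((t * (1 + (l : ℝ))) ^ 2) ≤ 1 := min_le_left _ _
      have m2 : min 1 ((t * (1 + (l : ℝ))) ^ 2) ≤ (t * (1 + l)) ^ 2 := min_le_right _ _
      have m0 : 0 ≤ min 1 ((t * (1 + (l : ℝ))) ^ 2) := le_min zero_le_one (sq_nonneg _)
      set μ := min 1 ((t * (1 + (l : ℝ))) ^ 2)
      have hab : (a + b) ^ 2 ≤ 2 * a ^ 2 + 2 * b ^ 2 := by nlinarith [sq_nonneg (a - b)]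
      calc (a + b) ^ 2 * P * μ ≤ (2 * a ^ 2 + 2 * b ^ 2) * P * μ := by gcongr
        _ = 2 * a ^ 2 * P * μ + 2 * b ^ 2 * P * μ := by ring
        _ ≤ 2 * a ^ 2 * P * 1 + 2 * b ^ 2 * P * (t * (1 + l)) ^ 2 := by gcongr
        _ = _ := by ring
    have hsum : specK d n t u ≤ 2 * specSq d n v
        + ENNReal.ofReal (2 * t ^ 2) * specSq d ((n + 1 : ℕ) : ℝ) w := by
      rw [specSq, specSq, ← ENNReal.tsum_mul_left, ← ENNReal.tsum_mul_left, ← ENNReal.tsum_add]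
      refine ENNReal.tsum_le_tsum fun l => ?_
      refine (ENNReal.ofReal_le_ofReal (hterm l)).trans ?_
      rw [ENNReal.ofReal_add (by positivity) (by positivity), ENNReal.ofReal_mul (by positivity),
        ENNReal.ofReal_mul (p := 2 * t ^ 2) (by positivity), ENNReal.ofReal_ofNat]
    have n1 := h₁ v hvi
    have n2 := h₂ w hwi
    rw [← intNorm_sq] at n1 n2
    set N := intNorm d n v
    set M := intNorm d (n + 1) w
    have b1 : N ^ 2 ≤ (N + ENNReal.ofReal t * M) ^ 2 := by gcongr; exact le_self_add
    have b2 : (ENNReal.ofReal t * M) ^ 2 ≤ (N + ENNReal.ofReal t * M) ^ 2 := by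
      gcongr; exact le_add_self
    calc specK d n t u ≤ 2 * (ENNReal.ofReal K₁ * N ^ 2)
          + ENNReal.ofReal (2 * t ^ 2) * (ENNReal.ofReal K₂ * M ^ 2) := by
          refine hsum.trans ?_
          gcongr
      _ = 2 * (ENNReal.ofReal K₁ * N ^ 2 + ENNReal.ofReal K₂ * (ENNReal.ofReal t * M) ^ 2) := by
          rw [ENNReal.ofReal_mul (by norm_num), ENNReal.ofReal_pow ht.le, ENNReal.ofReal_ofNat]
          ring
      _ ≤ 2 * (ENNReal.ofReal K₁ * (N + ENNReal.ofReal t * M) ^ 2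
          + ENNReal.ofReal K₂ * (N + ENNReal.ofReal t * M) ^ 2) := by gcongr
      _ = _ := by
          rw [hK, ENNReal.ofReal_mul (by norm_num), ENNReal.ofReal_add hK₁.le hK₂.le,
            ENNReal.ofReal_ofNat]
          ring
  -- The infimum defining the `K`-functional is over unsquared norms, so the square root is taken
  -- before passing to it.
  have hroot : (specK d n t u / ENNReal.ofReal K) ^ (1 / 2 : ℝ) ≤ kFunctional d n t u := by
    refine le_iInf₂ fun v w => le_iInf₂ fun hv hw => le_iInf fun huv => ?_
    have h := ENNReal.div_le_of_le_mul' (key v w hv hw huv)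
    refine (ENNReal.rpow_le_rpow h (by norm_num)).trans_eq ?_
    rw [← ENNReal.rpow_natCast, ← ENNReal.rpow_mul]; norm_num
  have h2 := pow_le_pow_left' hroot 2
  rw [← ENNReal.rpow_natCast, ← ENNReal.rpow_mul] at h2
  norm_num at h2
  rwa [ENNReal.div_le_iff' hK0 ENNReal.ofReal_ne_top] at h2

/-- Putting the degrees with `t(1+l) ≤ 1` into `w` and the others into `v` attains the minimum in
every degree. Only finitely many degrees go into `w`, so it is a polynomial. -/
theorem kFunctional_sq_le_specK {d : ℕ} (hd : 2 ≤ d) (n : ℕ) : ∃ K : ℝ, 0 < K ∧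
    ∀ u : ℝ → ℝ, Integrable u (wm d 0) → specSq d n u < ⊤ → ∀ t > 0,
      kFunctional d n t u ^ 2 ≤ ENNReal.ofReal K * specK d n t u := by
  obtain ⟨K₁, hK₁, h₁⟩ := intNormSq_le_specSq hd n
  obtain ⟨K₂, hK₂, h₂⟩ := intNormSq_le_specSq hd (n + 1)
  refine ⟨2 * (K₁ + K₂), by positivity, fun u hu hfin t ht => ?_⟩
  have hfs : {l : ℕ | t * (1 + (l : ℝ)) ≤ 1}.Finite := by
    refine (Set.finite_Iio ⌈1 / t⌉₊).subset fun l hl => ?_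
    rw [mem_Iio, Nat.lt_ceil, lt_div_iff₀ ht]
    have : t * (1 + (l : ℝ)) ≤ 1 := hl
    linarith
  set s := hfs.toFinset
  have hmem : ∀ l, l ∈ s ↔ t * (1 + (l : ℝ)) ≤ 1 := fun l => hfs.mem_toFinset
  set w : ℝ → ℝ := fun x => (partialPoly d s u).eval x with hw
  set v := u - w with hv
  have hwi : Integrable w (wm d 0) := integrable_polynomial hd 0 _
  have hvi : Integrable v (wm d 0) := hu.sub hwi
  have hsplit : specSq d n v + ENNReal.ofReal (t ^ 2) * specSq d ((n + 1 : ℕ) : ℝ) w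
      = specK d n t u := by
    rw [specSq, specSq, specK, ← ENNReal.tsum_mul_left, ← ENNReal.tsum_add]
    refine tsum_congr fun l => ?_
    have e : (1 + (l : ℝ)) ^ ((d : ℝ) - 2 + 2 * ((n + 1 : ℕ) : ℝ))
        = (1 + (l : ℝ)) ^ ((d : ℝ) - 2 + 2 * (n : ℝ)) * (1 + l) ^ 2 := by
      rw [rpow_spec, rpow_spec]; ring
    rw [e, hv, hw, coeff_sub_partialPoly hd s hu, coeff_partialPoly hd]
    have h0 : 0 ≤ t * (1 + (l : ℝ)) := by positivity
    split_ifs with h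
    · rw [hmem] at h
      rw [min_eq_right (by nlinarith), ← ENNReal.ofReal_mul (by positivity)]
      simp only [ne_eq, OfNat.ofNat_ne_zero, not_false_eq_true, zero_pow, zero_mul,
        ENNReal.ofReal_zero, zero_add]
      congr 1; ring
    · rw [hmem, not_le] at h
      rw [min_eq_left (by nlinarith)]
      simp
  have hvt : specSq d n v < ⊤ := by
    refine lt_of_le_of_lt (ENNReal.tsum_le_tsum fun l => ?_) hfin
    rw [hv, hw, coeff_sub_partialPoly hd s hu]
    refine ENNReal.ofReal_le_ofReal ?_
    split_ifs
    · simp only [ne_eq, OfNat.ofNat_ne_zero, not_false_eq_true, zero_pow, zero_mul]; positivity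
    · exact le_rfl
  have hwt : specSq d ((n + 1 : ℕ) : ℝ) w < ⊤ := by
    rw [specSq, tsum_eq_sum (s := s)]
    · exact ENNReal.sum_lt_top.mpr fun l _ => ENNReal.ofReal_lt_top
    · intro l hl
      rw [hw, coeff_partialPoly hd, if_neg hl]; simp
  have hle : kFunctional d n t u ≤ intNorm d n v + ENNReal.ofReal t * intNorm d (n + 1) w := by
    refine (iInf₂_le v w).trans ((iInf₂_le ((mem_IntV_iff hd n hvi).mpr hvt)
      ((mem_IntV_iff hd (n + 1) hwi).mpr hwt)).trans (iInf_le _ ?_))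
    rw [hv, sub_add_cancel]
  have n1 := h₁ v hvi
  have n2 := h₂ w hwi
  rw [← intNorm_sq] at n1 n2
  calc kFunctional d n t u ^ 2
      ≤ (intNorm d n v + ENNReal.ofReal t * intNorm d (n + 1) w) ^ 2 := by gcongr
    _ ≤ 2 * (intNorm d n v ^ 2 + (ENNReal.ofReal t * intNorm d (n + 1) w) ^ 2) :=
        add_sq_le_two_mul _ _
    _ ≤ 2 * (ENNReal.ofReal (K₁ + K₂) * specSq d n v
        + ENNReal.ofReal (t ^ 2)
          * (ENNReal.ofReal (K₁ + K₂) * specSq d ((n + 1 : ℕ) : ℝ) w)) := by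
        rw [mul_pow, ENNReal.ofReal_pow ht.le]
        gcongr
        · refine n1.trans ?_
          gcongr
          linarith
        · refine n2.trans ?_
          gcongr
          linarith
    _ = _ := by
        rw [← hsplit, ENNReal.ofReal_mul (by norm_num), ENNReal.ofReal_ofNat]; ring

/-- The constant `∫ t^{-2θ} min(1,t^2) dt/t`. -/
def interpConst (θ : ℝ) : ℝ≥0∞ :=
  ∫⁻ t in Ioi (0 : ℝ), ENNReal.ofReal (t ^ (-2 * θ) / t) * ENNReal.ofReal (min 1 (t ^ 2))

/-- Substitution `t = s/m`, under which `dt/t` is invariant. -/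
theorem lintegral_min_scale (θ : ℝ) {m : ℝ} (hm : 0 < m) :
    ∫⁻ t in Ioi (0 : ℝ), ENNReal.ofReal (t ^ (-2 * θ) / t) * ENNReal.ofReal (min 1 ((t * m) ^ 2))
      = ENNReal.ofReal (m ^ (2 * θ)) * interpConst θ := by
  have himg : (fun s : ℝ => s * m⁻¹) '' Ioi 0 = Ioi 0 := by
    ext x
    constructor
    · rintro ⟨s, hs, rfl⟩
      exact mul_pos hs (inv_pos.mpr hm)
    · intro hx
      exact ⟨x * m, mul_pos hx hm, by field_simp⟩
  have h := lintegral_image_eq_lintegral_abs_deriv_mul (s := Ioi (0 : ℝ))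
    (f := fun s : ℝ => s * m⁻¹) (f' := fun _ => m⁻¹) measurableSet_Ioi
    (fun x _ => by simpa using ((hasDerivAt_id x).mul_const m⁻¹).hasDerivWithinAt)
    ((mul_left_injective₀ (inv_ne_zero hm.ne')).injOn)
    (fun t => ENNReal.ofReal (t ^ (-2 * θ) / t) * ENNReal.ofReal (min 1 ((t * m) ^ 2)))
  rw [himg] at h
  rw [h, interpConst, ← lintegral_const_mul' _ _ ENNReal.ofReal_ne_top]
  refine setLIntegral_congr_fun measurableSet_Ioi fun s hs => ?_
  have hs' : (0 : ℝ) < s := hs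
  have e : |m⁻¹| * ((s * m⁻¹) ^ (-2 * θ) / (s * m⁻¹)) = m ^ (2 * θ) * (s ^ (-2 * θ) / s) := by
    rw [abs_of_pos (inv_pos.mpr hm), Real.mul_rpow hs'.le (inv_nonneg.mpr hm.le),
      Real.inv_rpow hm.le, neg_mul, Real.rpow_neg hm.le, inv_inv]
    field_simp
  rw [inv_mul_cancel_right₀ hm.ne', ← mul_assoc, ← mul_assoc, ← ENNReal.ofReal_mul (abs_nonneg _),
    ← ENNReal.ofReal_mul (p := m ^ (2 * θ)) (by positivity), e]

theorem interpConst_ne_zero (θ : ℝ) : interpConst θ ≠ 0 := by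
  refine (setLIntegral_pos_iff (by fun_prop)).mpr ?_ |>.ne'
  have : Ioi (0 : ℝ) ⊆ Function.support (fun t : ℝ =>
      ENNReal.ofReal (t ^ (-2 * θ) / t) * ENNReal.ofReal (min 1 (t ^ 2))) ∩ Ioi 0 := by
    intro t ht
    have ht' : (0 : ℝ) < t := ht
    refine ⟨mul_ne_zero ?_ ?_, ht⟩
    · simp only [ne_eq, ENNReal.ofReal_eq_zero, not_le]; positivity
    · simp only [ne_eq, ENNReal.ofReal_eq_zero, not_le]
      exact lt_min one_pos (by positivity)
  refine lt_of_lt_of_le ?_ (measure_mono this)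
  simp

/-- The integrand is `t^{1-2θ}` near `0`, integrable as `θ < 1`, and `t^{-2θ-1}` near infinity,
integrable as `θ > 0`. -/
theorem interpConst_ne_top {θ : ℝ} (h0 : 0 < θ) (h1 : θ < 1) : interpConst θ ≠ ⊤ := by
  have hsplit : interpConst θ
      ≤ (∫⁻ t in Ioc (0 : ℝ) 1, ENNReal.ofReal (t ^ (1 - 2 * θ)))
        + ∫⁻ t in Ioi (1 : ℝ), ENNReal.ofReal (t ^ (-2 * θ - 1)) := by
    rw [interpConst, ← Ioc_union_Ioi_eq_Ioi (zero_le_one (α := ℝ))]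
    refine (lintegral_union_le _ _ _).trans (add_le_add ?_ ?_)
    · refine setLIntegral_mono' measurableSet_Ioc fun t ht => ?_
      have ht' := ht.1
      rw [← ENNReal.ofReal_mul (by positivity)]
      refine ENNReal.ofReal_le_ofReal ?_
      refine (mul_le_mul_of_nonneg_left (min_le_right _ _) (by positivity)).trans_eq ?_
      rw [show 1 - 2 * θ = -2 * θ + 1 by ring, Real.rpow_add ht', Real.rpow_one]
      field_simp
    · refine setLIntegral_mono' measurableSet_Ioi fun t ht => ?_
      have ht' : (0 : ℝ) < t := zero_lt_one.trans ht
      rw [← ENNReal.ofReal_mul (by positivity)]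
      refine ENNReal.ofReal_le_ofReal ?_
      refine (mul_le_mul_of_nonneg_left (min_le_left _ _) (by positivity)).trans_eq ?_
      rw [Real.rpow_sub_one ht'.ne', mul_one]
  refine ne_top_of_le_ne_top (ENNReal.add_ne_top.mpr ⟨?_, ?_⟩) hsplit
  · have := intervalIntegral.intervalIntegrable_rpow' (a := 0) (b := 1) (r := 1 - 2 * θ)
      (by linarith)
    rw [intervalIntegrable_iff_integrableOn_Ioc_of_le zero_le_one] at this
    exact this.lintegral_lt_top.ne
  · exact (integrableOn_Ioi_rpow_of_lt (by linarith) one_pos).lintegral_lt_top.ne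

/-- Sum and integral are exchanged, and scaling by `m = 1 + l` produces the missing factor
`(1+l)^{2θ}` in each degree. -/
theorem lintegral_specK (d n : ℕ) (θ : ℝ) (u : ℝ → ℝ) :
    ∫⁻ t in Ioi (0 : ℝ), ENNReal.ofReal (t ^ (-2 * θ) / t) * specK d n t u
      = interpConst θ * specSq d (n + θ) u := by
  simp only [specK, ← ENNReal.tsum_mul_left]
  rw [lintegral_tsum fun l => by fun_prop, specSq, ← ENNReal.tsum_mul_left]
  refine tsum_congr fun l => ?_
  have hm : (0 : ℝ) < 1 + l := by positivity
  set P := coeff d l u ^ 2 * (1 + (l : ℝ)) ^ ((d : ℝ) - 2 + 2 * (n : ℝ)) with hP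
  have hP0 : 0 ≤ P := by positivity
  have e1 : ∀ t : ℝ, ENNReal.ofReal (t ^ (-2 * θ) / t)
      * ENNReal.ofReal (P * min 1 ((t * (1 + l)) ^ 2))
      = ENNReal.ofReal P * (ENNReal.ofReal (t ^ (-2 * θ) / t)
        * ENNReal.ofReal (min 1 ((t * (1 + l)) ^ 2))) := by
    intro t
    rw [ENNReal.ofReal_mul hP0]; ring
  simp only [e1]
  rw [lintegral_const_mul' _ _ ENNReal.ofReal_ne_top, lintegral_min_scale θ hm, ← mul_assoc,
    ← ENNReal.ofReal_mul hP0, mul_comm]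
  congr 2
  rw [hP, mul_assoc, ← Real.rpow_add hm]
  congr 2; ring

/-! ### The spaces `V^η` in terms of coefficients -/

/-- The norm bounds of the theorem assume only membership in `V^η`. In the fractional case a finite
norm forces a finite `K`-functional at some `t`, hence a splitting into integrable functions. -/
theorem integrable_of_mem_VSpace {d : ℕ} (hd : 2 ≤ d) {η : ℝ} {u : ℝ → ℝ} (h : u ∈ VSpace d η) :
    Integrable u (wm d 0) := by
  unfold VSpace at h
  split_ifs at h with hη
  · exact integrable_of_intNorm_lt_top hd h.1
  · have hK : ∃ t > 0, kFunctional d ⌊η⌋₊ t u < ⊤ := by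
      by_contra! hcon
      have htop : ∀ t > 0, kFunctional d ⌊η⌋₊ t u = ⊤ := fun t ht => top_le_iff.mp (hcon t ht)
      have h1 : interpNormSq d ⌊η⌋₊ (η - ⌊η⌋₊) u = ∫⁻ _ in Ioi (0 : ℝ), ⊤ := by
        refine setLIntegral_congr_fun measurableSet_Ioi fun t ht => ?_
        have ht' : (0 : ℝ) < t := ht
        rw [htop t ht', ENNReal.top_pow two_ne_zero, ENNReal.mul_top]
        simp only [ne_eq, ENNReal.ofReal_eq_zero, not_le]
        positivity
      have h2 : interpNormSq d ⌊η⌋₊ (η - ⌊η⌋₊) u < ⊤ := h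
      rw [h1] at h2
      simp at h2
    obtain ⟨t, _, ht⟩ := hK
    simp only [kFunctional, iInf_lt_iff] at ht
    obtain ⟨v, w, hv, hw, huv, _⟩ := ht
    have hi := (integrable_of_intNorm_lt_top hd hv.1).add (integrable_of_intNorm_lt_top hd hw.1)
    rw [EventuallyEq, ← ae_wm d 0] at huv
    exact hi.congr (EventuallyEq.symm huv)

theorem specSq_mono (d : ℕ) {s t : ℝ} (h : s ≤ t) (u : ℝ → ℝ) : specSq d s u ≤ specSq d t u := by
  refine ENNReal.tsum_le_tsum fun l => ENNReal.ofReal_le_ofReal ?_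
  refine mul_le_mul_of_nonneg_left ?_ (sq_nonneg _)
  exact Real.rpow_le_rpow_of_exponent_le (by linarith [(Nat.cast_nonneg l : (0 : ℝ) ≤ l)])
    (by linarith)

theorem interpNormSq_equiv {d : ℕ} (hd : 2 ≤ d) (n : ℕ) {θ : ℝ} (h0 : 0 < θ) (h1 : θ < 1) :
    ∃ K : ℝ, 0 < K ∧ ∀ u : ℝ → ℝ, Integrable u (wm d 0) →
      specSq d (n + θ) u ≤ ENNReal.ofReal K * interpNormSq d n θ u ∧
      interpNormSq d n θ u ≤ ENNReal.ofReal K * specSq d (n + θ) u := by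
  obtain ⟨K₁, hK₁, h₁⟩ := specK_le_kFunctional_sq hd n
  obtain ⟨K₂, hK₂, h₂⟩ := kFunctional_sq_le_specK hd n
  have hI0 := interpConst_ne_zero θ
  have hIt := interpConst_ne_top h0 h1
  have hIp : 0 < (interpConst θ).toReal := ENNReal.toReal_pos hI0 hIt
  set I := (interpConst θ).toReal with hI
  have hIe : interpConst θ = ENNReal.ofReal I := (ENNReal.ofReal_toReal hIt).symm
  refine ⟨K₁ / I + K₂ * I, by positivity, fun u hu => ⟨?_, ?_⟩⟩
  · have hle : interpConst θ * specSq d (n + θ) u ≤ ENNReal.ofReal K₁ * interpNormSq d n θ u := by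
      rw [← lintegral_specK, interpNormSq, ← lintegral_const_mul' _ _ ENNReal.ofReal_ne_top]
      refine setLIntegral_mono' measurableSet_Ioi fun t ht => ?_
      refine (mul_le_mul_right (h₁ u t ht) _).trans_eq ?_
      ring
    have h3 : specSq d (n + θ) u ≤ ENNReal.ofReal (K₁ / I) * interpNormSq d n θ u := by
      rw [mul_comm] at hle
      refine ((ENNReal.le_div_iff_mul_le (Or.inl hI0) (Or.inl hIt)).mpr hle).trans_eq ?_
      rw [ENNReal.ofReal_div_of_pos hIp, ← hIe, div_eq_mul_inv, div_eq_mul_inv]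
      ring
    refine h3.trans ?_
    gcongr
    have : 0 < K₂ * I := by positivity
    linarith
  · by_cases htop : specSq d (n + θ) u = ⊤
    · rw [htop, ENNReal.mul_top]
      · exact le_top
      · simp only [ne_eq, ENNReal.ofReal_eq_zero, not_le]; positivity
    · have hn : specSq d n u < ⊤ :=
        (specSq_mono d (by linarith) u).trans_lt (lt_top_iff_ne_top.mpr htop)
      have h3 : interpNormSq d n θ u
          ≤ ENNReal.ofReal K₂ * (interpConst θ * specSq d (n + θ) u) := by
        rw [← lintegral_specK, interpNormSq, ← lintegral_const_mul' _ _ ENNReal.ofReal_ne_top]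
        refine setLIntegral_mono' measurableSet_Ioi fun t ht => ?_
        refine (mul_le_mul_right (h₂ u hu hn t ht) _).trans_eq ?_
        ring
      refine h3.trans ?_
      rw [hIe, ← mul_assoc, ← ENNReal.ofReal_mul hK₂.le]
      gcongr
      have : 0 < K₁ / I := by positivity
      linarith

theorem VSpace_equiv {d : ℕ} (hd : 2 ≤ d) {η : ℝ} (hη : 0 ≤ η) :
    ∃ K : ℝ, 0 < K ∧ ∀ u : ℝ → ℝ, Integrable u (wm d 0) →
      (u ∈ VSpace d η ↔ specSq d η u < ⊤) ∧
      specSq d η u ≤ ENNReal.ofReal K * VNormSq d η u ∧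
      VNormSq d η u ≤ ENNReal.ofReal K * specSq d η u := by
  unfold VSpace VNormSq
  split_ifs with h
  · obtain ⟨K₁, hK₁, h₁⟩ := specSq_le_intNormSq hd ⌊η⌋₊
    obtain ⟨K₂, hK₂, h₂⟩ := intNormSq_le_specSq hd ⌊η⌋₊
    refine ⟨K₁ + K₂, by positivity, fun u hu => ?_⟩
    have h3 := mem_IntV_iff hd ⌊η⌋₊ hu
    have h4 := h₁ u hu
    have h5 := h₂ u hu
    rw [← h] at h3 h4 h5
    refine ⟨h3, h4.trans ?_, h5.trans ?_⟩
    · gcongr; linarith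
    · gcongr; linarith
  · have hlt : (⌊η⌋₊ : ℝ) < η := lt_of_le_of_ne (Nat.floor_le hη) (Ne.symm h)
    obtain ⟨K, hK, h₁⟩ := interpNormSq_equiv hd ⌊η⌋₊ (θ := η - ⌊η⌋₊) (by linarith)
      (by linarith [Nat.lt_floor_add_one η])
    refine ⟨K, hK, fun u hu => ?_⟩
    have h2 := h₁ u hu
    rw [add_sub_cancel] at h2
    refine ⟨⟨fun h3 => ?_, fun h3 => ?_⟩, h2⟩
    · exact h2.1.trans_lt (ENNReal.mul_lt_top ENNReal.ofReal_lt_top h3)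
    · exact h2.2.trans_lt (ENNReal.mul_lt_top ENNReal.ofReal_lt_top h3)

/-! ### Comparing the weights `ℓ^p` and `(1+ℓ)^p` -/

/-- For `l ≥ 1` one has `1 + l ≤ 2l`. Degree `0` needs the separate term, because `0^p = 0` for `p >
0`. -/
theorem mul_one_add_rpow_le {a : ℕ → ℝ} (ha : ∀ l, 0 ≤ a l) {p : ℝ} (hp : 0 ≤ p) (l : ℕ) :
    a l * (1 + (l : ℝ)) ^ p ≤ 2 ^ p * ((if l = 0 then a 0 else 0) + a l * (l : ℝ) ^ p) := by
  have h2 : (1 : ℝ) ≤ 2 ^ p := Real.one_le_rpow one_le_two hp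
  split_ifs with h
  · subst h
    have h3 : (0 : ℝ) ≤ ((0 : ℕ) : ℝ) ^ p := by positivity
    have h4 := ha 0
    have h5 := mul_nonneg h4 h3
    simp only [Nat.cast_zero, add_zero, Real.one_rpow, mul_one] at *
    nlinarith
  · have hl : (1 : ℝ) ≤ l := by exact_mod_cast Nat.one_le_iff_ne_zero.mpr h
    have h3 : (1 + (l : ℝ)) ^ p ≤ 2 ^ p * (l : ℝ) ^ p := by
      rw [← Real.mul_rpow (by norm_num) (by linarith)]
      exact Real.rpow_le_rpow (by linarith) (by linarith) hp
    rw [zero_add]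
    nlinarith [mul_le_mul_of_nonneg_left h3 (ha l)]

theorem mul_rpow_le_mul_one_add_rpow {a : ℕ → ℝ} (ha : ∀ l, 0 ≤ a l) {p : ℝ} (hp : 0 ≤ p)
    (l : ℕ) : a l * (l : ℝ) ^ p ≤ a l * (1 + (l : ℝ)) ^ p :=
  mul_le_mul_of_nonneg_left (Real.rpow_le_rpow (by positivity) (by linarith) hp) (ha l)

theorem summable_ite_zero (b : ℝ) : Summable fun l : ℕ => if l = 0 then b else 0 :=
  (hasSum_ite_eq 0 b).summable

theorem summable_mul_rpow_iff {a : ℕ → ℝ} (ha : ∀ l, 0 ≤ a l) {p : ℝ} (hp : 0 ≤ p) :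
    (Summable fun l : ℕ => a l * (l : ℝ) ^ p) ↔ Summable fun l : ℕ => a l * (1 + (l : ℝ)) ^ p := by
  constructor <;> intro h
  · exact Summable.of_nonneg_of_le (fun l => mul_nonneg (ha l) (by positivity))
      (mul_one_add_rpow_le ha hp) (((summable_ite_zero (a 0)).add h).mul_left _)
  · exact Summable.of_nonneg_of_le (fun l => mul_nonneg (ha l) (by positivity))
      (mul_rpow_le_mul_one_add_rpow ha hp) h

theorem tsum_mul_rpow_bounds {a : ℕ → ℝ} (ha : ∀ l, 0 ≤ a l) {p : ℝ} (hp : 0 ≤ p)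
    (h : Summable fun l : ℕ => a l * (l : ℝ) ^ p) :
    a 0 + ∑' l : ℕ, a l * (l : ℝ) ^ p ≤ 2 * ∑' l : ℕ, a l * (1 + (l : ℝ)) ^ p ∧
      ∑' l : ℕ, a l * (1 + (l : ℝ)) ^ p ≤ 2 ^ p * (a 0 + ∑' l : ℕ, a l * (l : ℝ) ^ p) := by
  have h' := (summable_mul_rpow_iff ha hp).mp h
  constructor
  · have h1 := h.tsum_le_tsum (mul_rpow_le_mul_one_add_rpow ha hp) h'
    have h2 := h'.le_tsum 0 fun l _ => mul_nonneg (ha l) (by positivity)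
    simp only [Nat.cast_zero, add_zero, Real.one_rpow, mul_one] at h2
    linarith
  · refine (h'.tsum_le_tsum (mul_one_add_rpow_le ha hp)
      (((summable_ite_zero (a 0)).add h).mul_left _)).trans_eq ?_
    rw [tsum_mul_left, (summable_ite_zero (a 0)).tsum_add h, tsum_ite_eq]

theorem specSq_lt_top_iff (d : ℕ) (s : ℝ) (u : ℝ → ℝ) : specSq d s u < ⊤ ↔
    Summable fun l : ℕ => coeff d l u ^ 2 * (1 + (l : ℝ)) ^ ((d : ℝ) - 2 + 2 * s) := by
  constructor
  · intro h
    exact summable_of_tsum_ofReal_ne_top (fun l => by positivity) h.ne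
  · intro h
    rw [specSq, ← ENNReal.ofReal_tsum_of_nonneg (fun l => by positivity) h]
    exact ENNReal.ofReal_lt_top

/-! ### Kernels -/

theorem sphereArea_pos {d : ℕ} (hd : 2 ≤ d) : 0 < sphereArea d := by
  have hd' : (2 : ℝ) ≤ d := by exact_mod_cast hd
  have := Real.Gamma_pos_of_pos (show 0 < 1 + ((d : ℝ) - 2) / 2 by linarith)
  unfold sphereArea
  positivity

theorem kernelInner_eq {d : ℕ} (hd : 2 ≤ d) (A : ℕ → ℝ) {x : ℝ} (hx : x ∈ Icc (-1 : ℝ) 1) :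
    kernelInner d A x
      = (sphereArea d)⁻¹ * ∑' l, A l * harmDim l d * (zpoly d l).eval x := by
  rw [kernelInner, kernelDist, Real.cos_arccos hx.1 hx.2, one_div]
  congr 1
  refine tsum_congr fun l => ?_
  rw [zonal_eq_eval hd]; ring

theorem kernel_term_bound {d : ℕ} (hd : 2 ≤ d) {A : ℕ → ℝ} (hA : ∀ l, 0 ≤ A l) (l : ℕ) {x : ℝ}
    (hx : x ∈ Icc (-1 : ℝ) 1) :
    ‖A l * harmDim l d * (zpoly d l).eval x‖ ≤ A l * harmDim l d := by
  have h0 : 0 ≤ A l * harmDim l d := mul_nonneg (hA l) (harmDim_pos hd l).le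
  rw [norm_mul, Real.norm_of_nonneg h0]
  exact mul_le_of_le_one_right h0 (abs_zpoly_eval_le_one hd l hx)

/-- Since `|Q_l| ≤ 1`, the series converges uniformly on `[-1,1]` and the kernel is continuous,
hence bounded. -/
theorem memLp_kernelInner {d : ℕ} (hd : 2 ≤ d) {A : ℕ → ℝ} (hA : ∀ l, 0 ≤ A l)
    (hs : Summable fun l => A l * harmDim l d) : MemLp (kernelInner d A) 2 (wm d 0) := by
  have := isFiniteMeasure_wm hd 0
  have hc : ContinuousOn (kernelInner d A) (Icc (-1 : ℝ) 1) := by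
    refine ContinuousOn.congr ?_ fun x hx => kernelInner_eq hd A hx
    exact continuousOn_const.mul (continuousOn_tsum
      (fun l => by fun_prop) hs fun l x hx => kernel_term_bound hd hA l hx)
  obtain ⟨K, hK⟩ := isCompact_Icc.exists_bound_of_continuousOn hc
  refine MemLp.of_bound (aestronglyMeasurable_wm_iff.mpr
    ((hc.mono Ioo_subset_Icc_self).aestronglyMeasurable measurableSet_Ioo)) K ?_
  filter_upwards [ae_wm_mem d 0] with x hx using hK x (Ioo_subset_Icc_self hx)

/-- The same bound permits termwise integration, and orthogonality leaves one term. The factor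
`znorm · harmDim` does not depend on the degree, so the coefficient is a fixed multiple of `A m`. -/
theorem coeff_kernelInner {d : ℕ} (hd : 2 ≤ d) {A : ℕ → ℝ} (hA : ∀ l, 0 ≤ A l)
    (hs : Summable fun l => A l * harmDim l d) (m : ℕ) :
    coeff d m (kernelInner d A) = (sphereArea d)⁻¹ * (A m * (znorm d m * harmDim m d)) := by
  have := isFiniteMeasure_wm hd 0
  have hint : ∀ l, Integrable (fun x => A l * harmDim l d * (zpoly d l).eval x
      * (zpoly d m).eval x) (wm d 0) := fun l =>
    integrable_mul_polynomial ((integrable_polynomial hd 0 _).const_mul _) _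
  have hb : ∀ l, ∫ x, ‖A l * harmDim l d * (zpoly d l).eval x * (zpoly d m).eval x‖ ∂wm d 0
      ≤ A l * harmDim l d * (wm d 0).real univ := by
    intro l
    have h0 : 0 ≤ A l * harmDim l d := mul_nonneg (hA l) (harmDim_pos hd l).le
    calc _ ≤ ∫ _, A l * harmDim l d ∂wm d 0 := by
          refine integral_mono_ae (hint l).norm (integrable_const _) ?_
          filter_upwards [ae_wm_mem d 0] with x hx
          have hx' := Ioo_subset_Icc_self hx
          rw [norm_mul]
          have h1 := kernel_term_bound hd hA l hx'
          have h2 : ‖(zpoly d m).eval x‖ ≤ 1 := abs_zpoly_eval_le_one hd m hx'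
          exact (mul_le_mul h1 h2 (norm_nonneg _) h0).trans_eq (mul_one _)
      _ = _ := by rw [integral_const, smul_eq_mul, mul_comm]
  have hsum := hasSum_integral_of_summable_integral_norm hint
    (Summable.of_nonneg_of_le (fun l => integral_nonneg fun x => norm_nonneg _) hb
      (hs.mul_right _))
  have e : ∀ l, ∫ x, A l * harmDim l d * (zpoly d l).eval x * (zpoly d m).eval x ∂wm d 0
      = if l = m then A m * (znorm d m * harmDim m d) else 0 := by
    intro l
    simp only [mul_assoc (A l * harmDim l d)]
    rw [integral_const_mul]
    split_ifs with h
    · subst h; rw [znorm]; ring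
    · rw [integral_zpoly_mul_zpoly_of_ne hd h, mul_zero]
  simp only [e] at hsum
  have h2 := hsum.unique (hasSum_ite_eq m _)
  rw [coeff_eq_integral hd, ← h2, ← integral_const_mul]
  refine integral_congr_ae ?_
  filter_upwards [ae_wm_mem d 0] with x hx
  rw [kernelInner_eq hd A (Ioo_subset_Icc_self hx), mul_assoc, tsum_mul_right]

theorem memLp_weighted_iff {d n : ℕ} {v : ℝ → ℝ}
    (hv : AEStronglyMeasurable v (volume.restrict (Ioo (-1 : ℝ) 1))) :
    MemLp (fun x => (1 - x ^ 2) ^ (((d : ℝ) - 3) / 4 + (n : ℝ) / 2) * v x) 2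
      (volume.restrict (Ioo (-1 : ℝ) 1)) ↔ MemLp v 2 (wm d n) := by
  have hm : Measurable fun x : ℝ => (1 - x ^ 2) ^ (((d : ℝ) - 3) / 4 + (n : ℝ) / 2) := by fun_prop
  have hm2 : AEStronglyMeasurable (fun x => (1 - x ^ 2) ^ (((d : ℝ) - 3) / 4 + (n : ℝ) / 2) * v x)
      (volume.restrict (Ioo (-1 : ℝ) 1)) := hm.aestronglyMeasurable.mul hv
  rw [memLp_two_iff_integrable_sq hm2,
    memLp_two_iff_integrable_sq (aestronglyMeasurable_wm_iff.mpr hv), integrable_wm_iff]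
  refine integrableOn_congr_fun (fun x hx => ?_) measurableSet_Ioo
  have hp := one_sub_sq_pos hx
  simp only [mul_pow]
  rw [← Real.rpow_mul_natCast hp.le, weight, mul_comm]
  congr 2
  push_cast; ring

/-- Only the derivative of order `n` is assumed here, none of intermediate order. This suffices
because the terms of orders `0` and `n` already control the full spectral weight, and order `0` is
supplied by `u` being in `L^2(w_0)`. -/
theorem exists_weakDeriv_iff_specSq {d : ℕ} (hd : 2 ≤ d) (n : ℕ) {u : ℝ → ℝ}
    (hu : MemLp u 2 (wm d 0)) :
    (∃ v, HasWeakDeriv n u v ∧ MemLp v 2 (wm d n)) ↔ specSq d n u < ⊤ := by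
  have := isFiniteMeasure_wm hd 0
  have hui := hu.integrable one_le_two
  rw [specSq_lt_top_iff]
  have h0 : Summable fun l => coeff d l u ^ 2 / znorm d l := by
    have := (hasSum_zcoef_mul_zcoef hd hu hu).summable
    refine this.congr fun l => ?_
    rw [eig_zero, one_mul, ← coeff_eq_zcoef hd, sq]
  constructor
  · rintro ⟨v, hv, hv2⟩
    obtain ⟨K, hK, h⟩ := le_specTerm hd n
    have h1 : Summable fun l => specTerm d 0 l u := by
      simpa only [specTerm, eig_zero, one_mul] using h0
    have h2 : Summable fun l => specTerm d n l u := (hv.hasSum_coeff_sq hd hui hv2).summable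
    exact Summable.of_nonneg_of_le (fun l => by positivity) (h u) ((h1.add h2).mul_left K)
  · intro hs
    obtain ⟨K, hK, h⟩ := specTerm_le hd n
    exact exists_hasWeakDeriv_of_summable hd n hui h0
      (Summable.of_nonneg_of_le (fun l => specTerm_nonneg hd n l u)
        (fun l => h u l n le_rfl) (hs.mul_left K))

/-- Restricting to `l ≥ n` drops finitely many terms and does not affect summability. -/
theorem memℓp_iff_summable_mul_rpow {d : ℕ} (n : ℕ) (A : ℕ → ℝ) :
    Memℓp (fun l : Ici n => ((l : ℕ) : ℝ) ^ ((d : ℝ) / 2 - 1 + n) * A l) 2 ↔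
      Summable fun l : ℕ => A l ^ 2 * (l : ℝ) ^ ((d : ℝ) - 2 + 2 * (n : ℝ)) := by
  rw [memℓp_gen_iff (by norm_num), ← (Set.finite_Iio n).summable_compl_iff, compl_Iio]
  refine summable_congr fun l => ?_
  simp only [ENNReal.toReal_ofNat, Real.rpow_ofNat, Real.norm_eq_abs, sq_abs, Function.comp,
    mul_pow]
  rw [← Real.rpow_mul_natCast (by positivity), mul_comm]
  congr 2
  push_cast; ring

end IsoGRF

end

/-! ### Assembly of the two parts of the theorem -/

theorem mainTheorem12 (d : ℕ) (hd : 2 ≤ d) :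
    (∀ η : ℝ, 0 ≤ η →
      (∀ u : ℝ → ℝ,
        IntegrableOn (fun x => u x * IsoGRF.weight d 0 x) (Ioo (-1 : ℝ) 1) →
          (u ∈ IsoGRF.VSpace d η ↔
            Summable fun l : ℕ => IsoGRF.coeff d l u ^ 2 * (l : ℝ) ^ ((d : ℝ) - 2 + 2 * η))) ∧
      ∃ c C : ℝ, 0 < c ∧ 0 < C ∧ ∀ u ∈ IsoGRF.VSpace d η,
        ENNReal.ofReal (c * (IsoGRF.coeff d 0 u ^ 2
            + ∑' l : ℕ, IsoGRF.coeff d l u ^ 2 * (l : ℝ) ^ ((d : ℝ) - 2 + 2 * η)))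
          ≤ IsoGRF.VNormSq d η u ∧
        IsoGRF.VNormSq d η u
          ≤ ENNReal.ofReal (C * (IsoGRF.coeff d 0 u ^ 2
            + ∑' l : ℕ, IsoGRF.coeff d l u ^ 2 * (l : ℝ) ^ ((d : ℝ) - 2 + 2 * η)))) ∧
    (∀ A : ℕ → ℝ, (∀ l, 0 ≤ A l) → Summable (fun l : ℕ => A l * IsoGRF.harmDim l d) →
      ∀ n : ℕ,
        Memℓp (fun l : Ici n => ((l : ℕ) : ℝ) ^ ((d : ℝ) / 2 - 1 + n) * A l) 2 ↔
          ∃ v : ℝ → ℝ, IsoGRF.HasWeakDeriv n (IsoGRF.kernelInner d A) v ∧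
            MemLp (fun x => (1 - x ^ 2) ^ (((d : ℝ) - 3) / 4 + (n : ℝ) / 2) * v x) 2
              (volume.restrict (Ioo (-1 : ℝ) 1))) := by
  have hd' : (2 : ℝ) ≤ d := by exact_mod_cast hd
  refine ⟨fun η hη => ?_, fun A hA hs n => ?_⟩
  · obtain ⟨K, hK, h⟩ := IsoGRF.VSpace_equiv hd hη
    have hp : 0 ≤ (d : ℝ) - 2 + 2 * η := by linarith
    have hiff : ∀ u : ℝ → ℝ, Integrable u (IsoGRF.wm d 0) → (u ∈ IsoGRF.VSpace d η ↔
        Summable fun l : ℕ => IsoGRF.coeff d l u ^ 2 * (l : ℝ) ^ ((d : ℝ) - 2 + 2 * η)) := by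
      intro u hu
      rw [(h u hu).1, IsoGRF.specSq_lt_top_iff,
        IsoGRF.summable_mul_rpow_iff (fun l => sq_nonneg _) hp]
    -- `K` compares the norm with the weights `(1+l)^p`. Passing to the weights `l^p` plus the
    -- degree-zero term costs a further `2` below and `2^p` above.
    refine ⟨fun u hu => hiff u (IsoGRF.integrable_wm_iff.mpr hu), 1 / (2 * K),
      K * 2 ^ ((d : ℝ) - 2 + 2 * η), by positivity, by positivity, fun u hu => ?_⟩
    have hui := IsoGRF.integrable_of_mem_VSpace hd hu
    have hsum := (hiff u hui).mp hu
    obtain ⟨b1, b2⟩ := IsoGRF.tsum_mul_rpow_bounds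
      (a := fun l => IsoGRF.coeff d l u ^ 2) (fun l => sq_nonneg _) hp hsum
    have hsum' := (IsoGRF.summable_mul_rpow_iff
      (a := fun l => IsoGRF.coeff d l u ^ 2) (fun l => sq_nonneg _) hp).mp hsum
    obtain ⟨-, n1, n2⟩ := h u hui
    rw [IsoGRF.specSq, ← ENNReal.ofReal_tsum_of_nonneg (fun l => by positivity) hsum'] at n1 n2
    set X := ∑' l : ℕ, IsoGRF.coeff d l u ^ 2 * (1 + (l : ℝ)) ^ ((d : ℝ) - 2 + 2 * η)
    constructor
    · have hK0 : ENNReal.ofReal K ≠ 0 := by simpa using hK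
      have h3 : ENNReal.ofReal (X / K) ≤ IsoGRF.VNormSq d η u := by
        rw [ENNReal.ofReal_div_of_pos hK]
        exact ENNReal.div_le_of_le_mul' n1
      refine (ENNReal.ofReal_le_ofReal ?_).trans h3
      rw [div_mul_eq_mul_div, one_mul, div_le_div_iff₀ (by positivity) hK]
      nlinarith
    · refine n2.trans ?_
      rw [← ENNReal.ofReal_mul hK.le]
      refine ENNReal.ofReal_le_ofReal ?_
      rw [mul_assoc]
      exact mul_le_mul_of_nonneg_left b2 hK.le
  · obtain ⟨κ, hκ, hz⟩ := IsoGRF.exists_znorm_mul_harmDim hd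
    have hp : 0 ≤ (d : ℝ) - 2 + 2 * (n : ℝ) := by
      have : (0 : ℝ) ≤ n := by positivity
      linarith
    have hω := IsoGRF.sphereArea_pos hd
    -- The kernel coefficients are `κ A_l` divided by the sphere area; this nonzero factor does not
    -- affect square summability.
    have hconst : ((IsoGRF.sphereArea d)⁻¹ * κ) ^ 2 ≠ 0 := by positivity
    have hk := IsoGRF.memLp_kernelInner hd hA hs
    rw [IsoGRF.memℓp_iff_summable_mul_rpow,
      IsoGRF.summable_mul_rpow_iff (fun l => sq_nonneg _) hp, ← summable_mul_left_iff hconst]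
    trans IsoGRF.specSq d n (IsoGRF.kernelInner d A) < ⊤
    · rw [IsoGRF.specSq_lt_top_iff]
      refine summable_congr fun l => ?_
      rw [IsoGRF.coeff_kernelInner hd hA hs, hz]
      ring
    · rw [← IsoGRF.exists_weakDeriv_iff_specSq hd n hk]
      refine exists_congr fun v => and_congr_right fun hv => ?_
      exact (IsoGRF.memLp_weighted_iff hv.2.1.aestronglyMeasurable).symm
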